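/- **Definitions.** For an integer $d\ge 0$ let $\mathcal I_d$ be the class of $C^*$-algebras of the form $PM_r(C(X))P$, where $X$ is a compact subset of a finite CW complex $Y$ of covering dimension at most $d$, $r\ge 1$ is an integer, and $P\in M_r(C(X))$ is the restriction to $X$ of a projection in $M_r(C(Y))$. For a $C^*$-algebra $A$ and positive elements $a,b\in A$ write $a\lesssim b$ if there are $x_n\in A$ with $\|x_n^*bx_n-a\|\to 0$. A unital simple (in particular nonzero) $C^*$-algebra $A$ is in the class $\mathcal C_1$ if for every finite set $\mathcal F\subset A$, all $\epsilon>0$ and $\eta>0$, and every positive $a\in A\setminus\{0\}$, there are a nonzero projection $p\in A$, an integer $d\ge 0$ and a $C^*$-subalgebra $C\subset A$ with unit $1_C=p$ and $C\cong PM_r(C(X))P\in\mathcal I_d$, with $X\neq\emptyset$ and $P(x)\ne 0$ for all $x\in X$, such that $$\|pb-bp\|<\epsilon\ \text{ and }\ \operatorname{dist}(pbp,C)<\epsilon\ \text{ for all } b\in\mathcal F,\qquad \frac{d+1}{\operatorname{rank}P(x)}<\frac{\eta}{2}\ \text{ for all } x\in X,\qquad 1-p\lesssim a .$$ A separable $C^*$-algebra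 is *MF* if it is isomorphic to a $C^*$-subalgebra of $\prod_n M_{k_n}(\mathbb C)\big/\bigoplus_n M_{k_n}(\mathbb C)$ (bounded sequences modulo sequences converging to $0$ in norm) for some sequence of integers $k_n\ge 1$. It is *quasidiagonal* if it has a faithful representation $\pi$ on a Hilbert space $H$ for which there is an increasing sequence of finite rank projections $P_n$ on $H$, converging strongly to $1$, with $\|P_n\pi(a)-\pi(a)P_n\|\to 0$ for all $a$. **Theorem.** Let $A$ be a unital separable simple $C^*$-algebra in $\mathcal C_1$. Then $A$ is MF and quasidiagonal, and $A$ has a tracial state, i.e. a positive linear functional $\tau$ with $\tau(1)=1$ and $\tau(ab)=\tau(ba)$ for all $a,b\in A$. -/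

import Mathlib

open scoped ENNReal ComplexOrder

noncomputable section

/-- A topological space `X` has (Lebesgue) covering dimension at most `d`: every finite open cover
has an open refinement such that no point lies in more than `d + 1` of its members.  Grouping the
members of a refinement, it may be indexed by the original index set. -/
def CoveringDimLE (X : Type*) [TopologicalSpace X] (d : ℕ) : Prop :=
  ∀ (n : ℕ) (U : Fin n → Set X), (∀ i, IsOpen (U i)) → (⋃ i, U i) = Set.univ →
    ∃ V : Fin n → Set X, (∀ i, IsOpen (V i)) ∧ (∀ i, V i ⊆ U i) ∧ (⋃ i, V i) = Set.univ ∧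
      ∀ x : X, {i | x ∈ V i}.ncard ≤ d + 1

/-- `Y` admits the structure of a finite CW complex (attached inside the Hausdorff space `Y`). -/
def IsFiniteCW (Y : Type*) [TopologicalSpace Y] : Prop :=
  ∃ _ : Topology.CWComplex (Set.univ : Set Y),
    Topology.RelCWComplex.Finite (Set.univ : Set Y)

/-- The matrix `Q(x)`, for `Q ∈ M_r(C(X))` and `x ∈ X`. -/
def evalMatrix {X : Type*} [TopologicalSpace X] {r : ℕ}
    (Q : Matrix (Fin r) (Fin r) C(X, ℂ)) (x : X) : Matrix (Fin r) (Fin r) ℂ :=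
  Q.map fun f => f x

/-- The restriction of `Q ∈ M_r(C(Y))` to a subspace `X ⊆ Y`. -/
def restrictMatrix {Y : Type*} [TopologicalSpace Y] {r : ℕ} (X : Set Y)
    (Q : Matrix (Fin r) (Fin r) C(Y, ℂ)) : Matrix (Fin r) (Fin r) C(X, ℂ) :=
  Q.map fun f => f.restrict X

/-- The corner `P B P` of a `*`-algebra `B` at a projection `P`. -/
def cornerAlg {B : Type*} [Ring B] [StarRing B] [Algebra ℂ B]
    (P : B) (hP : IsStarProjection P) : NonUnitalStarSubalgebra ℂ B where
  carrier := {b | P * b = b ∧ b * P = b}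
  zero_mem' := by simp
  add_mem' := by
    rintro a b ⟨h1, h2⟩ ⟨h3, h4⟩
    exact ⟨by rw [mul_add, h1, h3], by rw [add_mul, h2, h4]⟩
  mul_mem' := by
    rintro a b ⟨h1, _⟩ ⟨_, h4⟩
    exact ⟨by rw [← mul_assoc, h1], by rw [mul_assoc, h4]⟩
  smul_mem' := by
    rintro c a ⟨h1, h2⟩
    exact ⟨by rw [mul_smul_comm, h1], by rw [smul_mul_assoc, h2]⟩
  star_mem' := by
    rintro a ⟨h1, h2⟩
    have hs : star P = P := hP.isSelfAdjoint
    refine ⟨?_, ?_⟩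
    · have := congrArg star h2
      rwa [star_mul, hs] at this
    · have := congrArg star h1
      rwa [star_mul, hs] at this

/-- The data of an algebra `P M_r(C(X)) P` in the class `I_d`: a finite CW complex `Y` of covering
dimension at most `d`, a compact subset `X ⊆ Y`, a matrix size `r ≥ 1` and a projection
`Q ∈ M_r(C(Y))`; the projection `P` is the restriction of `Q` to `X`. -/
structure HomogData (d : ℕ) where
  Y : Type
  [top : TopologicalSpace Y]
  [t2 : T2Space Y]
  isFiniteCW : IsFiniteCW Y
  dim_le : CoveringDimLE Y d
  X : Set Y
  isCompact : IsCompact X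
  r : ℕ
  r_pos : 0 < r
  Q : Matrix (Fin r) (Fin r) C(Y, ℂ)
  isProj : IsStarProjection Q

attribute [instance] HomogData.top HomogData.t2

namespace HomogData

variable {d : ℕ} (D : HomogData d)

/-- The projection `P = Q|_X ∈ M_r(C(X))`. -/
def P : Matrix (Fin D.r) (Fin D.r) C(D.X, ℂ) := restrictMatrix D.X D.Q

lemma isStarProjection_P : IsStarProjection D.P := by
  refine ⟨?_, ?_⟩
  · have h := D.isProj.isIdempotentElem
    have h' : D.Q * D.Q = D.Q := h
    change D.P * D.P = D.P
    ext i j x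
    have := congrArg (fun M : Matrix (Fin D.r) (Fin D.r) C(D.Y, ℂ) => M i j x.1) h'
    simpa [P, restrictMatrix, Matrix.mul_apply] using this
  · have h : star D.Q = D.Q := D.isProj.isSelfAdjoint
    change star D.P = D.P
    ext i j x
    have := congrArg (fun M : Matrix (Fin D.r) (Fin D.r) C(D.Y, ℂ) => M i j x.1) h
    simpa [P, restrictMatrix, Matrix.star_apply] using this

/-- The algebra `P M_r(C(X)) P`. -/
def algebra : NonUnitalStarSubalgebra ℂ (Matrix (Fin D.r) (Fin D.r) C(D.X, ℂ)) :=
  cornerAlg D.P D.isStarProjection_P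

/-- The rank of the projection `P(x)`. -/
def rankAt (x : D.X) : ℕ := (evalMatrix D.P x).rank

end HomogData

section CStar

variable (A : Type*) [CStarAlgebra A]

/-- A (nonzero) C⋆-algebra is simple: it has no closed two-sided ideals besides `0` and itself. -/
def IsSimpleCStar : Prop :=
  Nontrivial A ∧ ∀ I : TwoSidedIdeal A, IsClosed (I : Set A) → I = ⊥ ∨ I = ⊤

variable {A} in
/-- Cuntz subequivalence `a ≲ b`: there are `x_n ∈ A` with `x_n^* b x_n → a` in norm. -/
def CuntzLE (a b : A) : Prop :=
  ∃ x : ℕ → A, Filter.Tendsto (fun n => star (x n) * b * x n) Filter.atTop (nhds a)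

/-- The class `C_g` for `g : ℕ → ℕ` (membership of a C⋆-algebra which is, in addition, unital
and simple).  The unit `p` of the approximating algebra `C ≅ P M_r(C(X)) P` is a nonzero
projection (`X` is nonempty and `P` vanishes at no point of `X`). -/
def InClassC (g : ℕ → ℕ) [PartialOrder A] : Prop :=
  ∀ (F : Finset A) (ε : ℝ), 0 < ε → ∀ η : ℝ, 0 < η → ∀ a : A, 0 ≤ a → a ≠ 0 →
    ∃ (p : A) (C : NonUnitalStarSubalgebra ℂ A) (d : ℕ) (D : HomogData d),
      IsStarProjection p ∧
      IsClosed (C : Set A) ∧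
      Nonempty (D.algebra ≃⋆ₐ[ℂ] C) ∧
      (p ∈ C ∧ ∀ c ∈ C, p * c = c ∧ c * p = c) ∧
      (∀ b ∈ F, ‖p * b - b * p‖ < ε) ∧
      (∀ b ∈ F, Metric.infDist (p * b * p) (C : Set A) < ε) ∧
      D.X.Nonempty ∧
      (∀ x : D.X, 0 < D.rankAt x ∧ ((d : ℝ) + 1) / (D.rankAt x : ℝ) < η / ((g d : ℝ) + 1)) ∧
      CuntzLE (1 - p) a

/-- The class `C_1`, i.e. `C_g` for the constant function `g = 1`. -/
def InClassC1 [PartialOrder A] : Prop := InClassC A (fun _ => 1)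

/-- A (separable) C⋆-algebra is quasidiagonal: it has a faithful representation `π` on a Hilbert
space `H` with an increasing sequence of finite rank projections `P_n` on `H` converging
strongly to the identity (so that `H` is separable) such that `‖P_n π(a) - π(a) P_n‖ → 0` for
every `a`. -/
def IsQuasidiagonal : Prop :=
  ∃ (H : Type) (_ : NormedAddCommGroup H) (_ : InnerProductSpace ℂ H) (_ : CompleteSpace H)
    (π : A →⋆ₙₐ[ℂ] (H →L[ℂ] H)) (P : ℕ → (H →L[ℂ] H)),
      Function.Injective π ∧
      (∀ n, IsStarProjection (P n)) ∧
      (∀ n, FiniteDimensional ℂ (LinearMap.range (P n : H →ₗ[ℂ] H))) ∧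
      Monotone P ∧
      (∀ ξ : H, Filter.Tendsto (fun n => P n ξ) Filter.atTop (nhds ξ)) ∧
      ∀ a : A, Filter.Tendsto (fun n => ‖P n * π a - π a * P n‖) Filter.atTop (nhds 0)

variable {A} in
/-- A tracial state: a positive linear functional `τ` with `τ(1) = 1` and `τ(ab) = τ(ba)`. -/
structure IsTracialState [PartialOrder A] (τ : A →ₗ[ℂ] ℂ) : Prop where
  nonneg : ∀ a : A, 0 ≤ a → 0 ≤ τ a
  map_one : τ 1 = 1
  trace : ∀ a b : A, τ (a * b) = τ (b * a)

end CStar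

section MF

variable (B : ℕ → Type*) [∀ n, Nontrivial (B n)] [∀ n, CStarAlgebra (B n)]

/-- The ideal `⊕ B_n` of the sequences with `‖b_n‖ → 0` in the algebra `∏ B_n` of all norm
bounded sequences. -/
def c0Ideal : Ideal (lp B ∞) where
  carrier := {b | Filter.Tendsto (fun n => ‖b n‖) Filter.atTop (nhds 0)}
  zero_mem' := by simp
  add_mem' := by
    intro a b ha hb
    refine squeeze_zero (fun n => norm_nonneg _) (fun n => ?_) (by simpa using ha.add hb)
    simpa using norm_add_le (a n) (b n)
  smul_mem' := by
    intro c b hb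
    refine squeeze_zero (fun n => norm_nonneg _) (fun n => ?_)
      (by simpa using (Filter.Tendsto.const_mul ‖c‖ hb))
    simp only [smul_eq_mul, lp.infty_coeFn_mul, Pi.mul_apply]
    exact (norm_mul_le _ _).trans
      (mul_le_mul_of_nonneg_right (lp.norm_apply_le_norm (by simp) c n) (norm_nonneg _))

instance c0Ideal_isTwoSided : (c0Ideal B).IsTwoSided where
  mul_mem_of_left := by
    intro b c hb
    refine squeeze_zero (fun n => norm_nonneg _) (fun n => ?_)
      (by simpa using (Filter.Tendsto.mul_const ‖c‖ hb))
    simp only [lp.infty_coeFn_mul, Pi.mul_apply]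
    exact (norm_mul_le _ _).trans
      (mul_le_mul_of_nonneg_left (lp.norm_apply_le_norm (by simp) c n) (norm_nonneg _))

lemma star_mem_c0Ideal {b : lp B ∞} (hb : b ∈ c0Ideal B) : star b ∈ c0Ideal B := by
  change Filter.Tendsto (fun n => ‖(star b) n‖) Filter.atTop (nhds 0)
  simpa [lp.star_apply] using (show Filter.Tendsto (fun n => ‖b n‖) Filter.atTop (nhds 0) from hb)

/-- The quotient `∏ B_n / ⊕ B_n`. -/
abbrev ProdModSum : Type _ := lp B ∞ ⧸ c0Ideal B

/-- The involution of `∏ B_n / ⊕ B_n`, induced by that of `∏ B_n`. -/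
instance : Star (ProdModSum B) where
  star := Quotient.map' star (by
    intro a b h
    rw [Submodule.quotientRel_def] at h ⊢
    rw [← star_sub]
    exact star_mem_c0Ideal B h)

lemma ProdModSum.star_mk (b : lp B ∞) :
    star (Ideal.Quotient.mk (c0Ideal B) b : ProdModSum B) = Ideal.Quotient.mk _ (star b) := rfl

end MF

/-- A (separable) C⋆-algebra is MF: it is isomorphic to a C⋆-subalgebra of
`∏ M_{m_n}(ℂ) / ⊕ M_{m_n}(ℂ)` for some sequence of matrix sizes `m_n = k_n + 1 ≥ 1`. -/
def IsMF (A : Type*) [CStarAlgebra A] : Prop :=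
  ∃ (k : ℕ → ℕ)
    (φ : A →⋆ₙₐ[ℂ] ProdModSum fun n => CStarMatrix (Fin (k n + 1)) (Fin (k n + 1)) ℂ),
    Function.Injective φ

end

open scoped ENNReal ComplexOrder InnerProductSpace
open Filter Topology

/-! Membership in the class yields projections `p_n`, asymptotically central, and subalgebras `C_n`
with unit `p_n` that asymptotically exhaust `p_n A p_n`. Evaluation at a point where `P` does not
vanish gives each `C_n` a finite dimensional representation `ρ_n` with `ρ_n(p_n) ≠ 0`. Choosing `c_n
∈ C_n` with `c_n - a p_n → 0`, the maps `a ↦ ρ_n(c_n)` are asymptotically linear, multiplicative and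
`*`-preserving. The elements with `ρ_n(c_n) → 0` form a closed ideal, which misses `1` because
`‖ρ_n(p_n)‖ = 1`; simplicity makes it zero. This gives the MF embedding (`CornerSystem.isMF`), and
an ultralimit of the normalized traces of the `ρ_n` is a tracial state
(`CornerSystem.exists_tracialState`).

Quasidiagonality comes from a Baire category argument in the weak-* compact state space. Call a
state compatible with `n` if it is `1` at `p_n` and its restriction to `C_n` kills `ker ρ_n`. In its
GNS space the vectors from `C_n` span a finite dimensional subspace, almost invariant under a given
finite set of elements once `n` is large. Having such a subspace persists on a weak-* neighbourhood
(`eventually_almostReducing`). Compatible states of large index are dense by Hahn–Banach, because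
the `ρ_n` are asymptotically isometric along an ultrafilter (`Represents.tendsto_norm_rho`). Hence a
generic state has almost reducing subspaces for every finite set and tolerance
(`exists_state_almostReducing`).

In the GNS representation of that state, faithful by simplicity, the projections onto these
subspaces converge strongly to `1` and asymptotically commute with `A`. A norm-small perturbation
along a subsequence makes them increasing (`exists_monotone_submodule`). -/

/-- If a sequence of uniformly Lipschitz nonnegative functions tends to zero on a dense sequence,
it tends to zero everywhere. -/
lemma tendsto_zero_of_dense {A : Type*} [NormedAddCommGroup A] {f : ℕ → A → ℝ} {K : ℝ}
    (hK : 0 ≤ K) (h0 : ∀ n x, 0 ≤ f n x) (hL : ∀ n x y, f n x ≤ f n y + K * ‖x - y‖)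
    {u : ℕ → A} (hu : DenseRange u) (h : ∀ k, Tendsto (fun n => f n (u k)) atTop (𝓝 0)) (x : A) :
    Tendsto (fun n => f n x) atTop (𝓝 0) := by
  rw [Metric.tendsto_atTop]
  intro ε hε
  obtain ⟨k, hk⟩ := hu.exists_dist_lt x (ε := ε / (2 * (K + 1))) (by positivity)
  obtain ⟨N, hN⟩ := (Metric.tendsto_atTop.1 (h k)) (ε / 2) (by positivity)
  refine ⟨N, fun n hn => ?_⟩
  have h1 := hN n hn
  have h2 := hL n x (u k)
  rw [dist_eq_norm] at hk
  rw [Real.dist_eq, sub_zero, abs_of_nonneg (h0 _ _)] at h1 ⊢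
  have h3 : K * ‖x - u k‖ ≤ ε / 2 := by
    calc K * ‖x - u k‖ ≤ (K + 1) * (ε / (2 * (K + 1))) := by
          gcongr; linarith
      _ = ε / 2 := by field_simp
  linarith

/-! ### Corner systems and their construction from the class `C_1` -/

/-- Evaluation of matrices of continuous functions at a point, as a `*`-homomorphism into the
operators on a Euclidean space. -/
noncomputable def evalRep {X : Type*} [TopologicalSpace X] {r : ℕ} (x : X) :
    Matrix (Fin r) (Fin r) C(X, ℂ) →⋆ₙₐ[ℂ]
      (EuclideanSpace ℂ (Fin r) →L[ℂ] EuclideanSpace ℂ (Fin r)) where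
  toFun Q := Matrix.toEuclideanCLM (𝕜 := ℂ) (evalMatrix Q x)
  map_smul' c Q := by
    rw [MonoidHom.id_apply, ← map_smul]; rfl
  map_zero' := by
    rw [← map_zero (Matrix.toEuclideanCLM (𝕜 := ℂ) (n := Fin r))]; rfl
  map_add' Q R := by
    rw [← map_add]; rfl
  map_mul' Q R := by
    rw [← map_mul]
    congr 1
    ext i j
    simp [evalMatrix, Matrix.mul_apply]
  map_star' Q := by
    rw [← map_star]
    rfl

/-- A sequence of corners `p_n`, of `C⋆`-subalgebras `C_n` with unit `p_n` and of finite dimensional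
representations of the `C_n` which asymptotically exhausts `p_n A p_n` while `p_n` is
asymptotically central. -/
structure CornerSystem (A : Type*) [CStarAlgebra A] where
  p : ℕ → A
  isProj : ∀ n, IsStarProjection (p n)
  C : ℕ → NonUnitalStarSubalgebra ℂ A
  closed : ∀ n, IsClosed (C n : Set A)
  mem : ∀ n, p n ∈ C n
  left_unit : ∀ n, ∀ c ∈ C n, p n * c = c
  right_unit : ∀ n, ∀ c ∈ C n, c * p n = c
  k : ℕ → ℕ
  ρ : ∀ n, C n →⋆ₙₐ[ℂ] (EuclideanSpace ℂ (Fin (k n + 1)) →L[ℂ] EuclideanSpace ℂ (Fin (k n + 1)))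
  ρ_ne : ∀ n, ρ n ⟨p n, mem n⟩ ≠ 0
  comm : ∀ a, Tendsto (fun n => ‖p n * a - a * p n‖) atTop (𝓝 0)
  approx : ∀ a, ∃ c : ∀ n, C n, Tendsto (fun n => ‖(c n : A) - a * p n‖) atTop (𝓝 0)

lemma IsStarProjection.norm_le_one' {A : Type*} [CStarAlgebra A] {p : A}
    (hp : IsStarProjection p) : ‖p‖ ≤ 1 := by
  have h1 : ‖p‖ * ‖p‖ = ‖p‖ := by
    rw [← CStarRing.norm_star_mul_self, hp.isSelfAdjoint.star_eq, hp.isIdempotentElem.eq]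
  nlinarith [norm_nonneg p]

/-- Evaluation at a point where `P` does not vanish, as a representation of a copy of
`P M_r(C(X)) P`. -/
lemma HomogData.exists_rep {A : Type*} [CStarAlgebra A] {d : ℕ} (D : HomogData d)
    {C : NonUnitalStarSubalgebra ℂ A} (e : D.algebra ≃⋆ₐ[ℂ] C) {p : A} (hp : p ∈ C)
    (hunit : ∀ c ∈ C, c * p = c) {x : D.X} (hx : 0 < D.rankAt x) :
    ∃ k, ∃ ρ : C →⋆ₙₐ[ℂ] (EuclideanSpace ℂ (Fin (k + 1)) →L[ℂ]
      EuclideanSpace ℂ (Fin (k + 1))), ρ ⟨p, hp⟩ ≠ 0 := by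
  obtain ⟨k, hk⟩ : ∃ k, D.r = k + 1 := ⟨D.r - 1, by have := D.r_pos; omega⟩
  have key : ∃ ρ : C →⋆ₙₐ[ℂ] (EuclideanSpace ℂ (Fin D.r) →L[ℂ]
      EuclideanSpace ℂ (Fin D.r)), ρ ⟨p, hp⟩ ≠ 0 := by
    have hPm : D.P ∈ D.algebra :=
      ⟨D.isStarProjection_P.isIdempotentElem, D.isStarProjection_P.isIdempotentElem⟩
    obtain ⟨b, hb⟩ : ∃ b, e b = ⟨p, hp⟩ := ⟨e.symm _, e.apply_symm_apply _⟩
    -- An isomorphism carries unit to unit: `P b = b`, while `e (P b) = e(P) p = e(P)`.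
    have hbP : b = ⟨D.P, hPm⟩ := by
      have h1 : (⟨D.P, hPm⟩ : D.algebra) * b = b := Subtype.ext b.2.1
      rw [← h1]
      apply EquivLike.injective e
      rw [map_mul, hb]
      exact Subtype.ext (hunit _ (e ⟨D.P, hPm⟩).2)
    refine ⟨((evalRep x).comp (NonUnitalStarSubalgebraClass.subtype D.algebra)).comp
      (e.symm : C →⋆ₙₐ[ℂ] D.algebra), fun h => ?_⟩
    have h3 : e.symm ⟨p, hp⟩ = ⟨D.P, hPm⟩ := by
      rw [← hb, ← hbP]; exact e.symm_apply_apply _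
    have h4 : evalRep x (e.symm ⟨p, hp⟩ : D.algebra).1 = 0 := h
    rw [h3] at h4
    have h5 : evalMatrix D.P x = 0 := by
      have : Matrix.toEuclideanCLM (𝕜 := ℂ) (evalMatrix D.P x) = 0 := h4
      simpa using this
    rw [HomogData.rankAt, h5, Matrix.rank_zero] at hx
    exact lt_irrefl _ hx
  rw [hk] at key
  exact ⟨k, key⟩

/-- A diagonal choice: at stage `n` the finite set is an initial segment of a dense sequence and the
tolerance is `1/(n+1)`. All error functions are uniformly Lipschitz in `a`, so convergence on the
dense sequence spreads to all of `A`. Since `p_n` is almost central, approximating `p_n a p_n` is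
the same as approximating `a p_n`. -/
lemma nonempty_cornerSystem {A : Type*} [CStarAlgebra A] [PartialOrder A] [StarOrderedRing A]
    [TopologicalSpace.SeparableSpace A] [Nontrivial A] (hA : InClassC1 A) :
    Nonempty (CornerSystem A) := by
  classical
  have hA' := fun n : ℕ => hA
    ((Finset.range (n + 1)).image (TopologicalSpace.denseSeq A)) (1 / ((n : ℝ) + 1))
    (by positivity) 1 one_pos 1 zero_le_one one_ne_zero
  choose p C d D hp hC he hunit hcomm hdist hne hrank hcuntz using hA'
  replace he := fun n => Classical.choice (he n)
  choose x hx using hne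
  have hmem : ∀ (m n : ℕ), m ≤ n → TopologicalSpace.denseSeq A m ∈
      (Finset.range (n + 1)).image (TopologicalSpace.denseSeq A) := fun m n h =>
    Finset.mem_image_of_mem _ (by simp; omega)
  have hlim : Tendsto (fun n : ℕ => 1 / ((n : ℝ) + 1)) atTop (𝓝 0) :=
    tendsto_one_div_add_atTop_nhds_zero_nat
  have hp1 := fun n => (hp n).norm_le_one'
  have hc : ∀ a, Tendsto (fun n => ‖p n * a - a * p n‖) atTop (𝓝 0) := by
    refine tendsto_zero_of_dense (K := 2) (f := fun n a => ‖p n * a - a * p n‖) zero_le_two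
      (fun _ _ => norm_nonneg _) ?_ (TopologicalSpace.denseRange_denseSeq A) ?_
    · intro n a b
      have : p n * a - a * p n = (p n * b - b * p n) + (p n * (a - b) - (a - b) * p n) := by
        noncomm_ring
      rw [this]
      refine (norm_add_le _ _).trans (by
        gcongr
        refine (norm_sub_le _ _).trans ?_
        have h1 := norm_mul_le (p n) (a - b)
        have h2 := norm_mul_le (a - b) (p n)
        nlinarith [hp1 n, norm_nonneg (a - b)])
    · intro m
      refine squeeze_zero' (.of_forall fun _ => norm_nonneg _) ?_ hlim
      filter_upwards [eventually_ge_atTop m] with n hn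
      exact (hcomm n _ (hmem m n hn)).le
  have hd : ∀ a, Tendsto (fun n => Metric.infDist (p n * a * p n) (C n : Set A)) atTop (𝓝 0) := by
    refine tendsto_zero_of_dense (K := 1) (f := fun n a => Metric.infDist (p n * a * p n) (C n))
      zero_le_one (fun _ _ => Metric.infDist_nonneg) ?_ (TopologicalSpace.denseRange_denseSeq A) ?_
    · intro n a b
      refine (Metric.infDist_le_infDist_add_dist (y := p n * b * p n)).trans ?_
      gcongr
      rw [dist_eq_norm, ← sub_mul, ← mul_sub]
      have h1 := norm_mul_le (p n * (a - b)) (p n)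
      have h2 := norm_mul_le (p n) (a - b)
      nlinarith [hp1 n, norm_nonneg (a - b), norm_nonneg (p n * (a - b))]
    · intro m
      refine squeeze_zero' (.of_forall fun _ => Metric.infDist_nonneg) ?_ hlim
      filter_upwards [eventually_ge_atTop m] with n hn
      exact (hdist n _ (hmem m n hn)).le
  have hrep : ∀ n, ∃ k, ∃ ρ : C n →⋆ₙₐ[ℂ] (EuclideanSpace ℂ (Fin (k + 1)) →L[ℂ]
      EuclideanSpace ℂ (Fin (k + 1))), ρ ⟨p n, (hunit n).1⟩ ≠ 0 := fun n =>
    (D n).exists_rep (he n) (hunit n).1 (fun c hc => ((hunit n).2 c hc).2) (hrank n ⟨x n, hx n⟩).1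
  choose k ρ hρ using hrep
  refine ⟨⟨p, hp, C, hC, fun n => (hunit n).1, fun n c hc => ((hunit n).2 c hc).1,
    fun n c hc => ((hunit n).2 c hc).2, k, ρ, hρ, hc, fun a => ?_⟩⟩
  have hex : ∀ n, ∃ c : C n, dist (p n * a * p n) c <
      Metric.infDist (p n * a * p n) (C n : Set A) + 1 / ((n : ℝ) + 1) := by
    intro n
    have hne : (C n : Set A).Nonempty := ⟨_, (hunit n).1⟩
    obtain ⟨c, hc, h⟩ := (Metric.infDist_lt_iff hne).1
      (lt_add_of_pos_right (Metric.infDist (p n * a * p n) (C n : Set A))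
        (show (0 : ℝ) < 1 / ((n : ℝ) + 1) by positivity))
    exact ⟨⟨c, hc⟩, h⟩
  choose c hcd using hex
  refine ⟨c, squeeze_zero (fun _ => norm_nonneg _) (fun n => ?_)
    (by simpa using ((hd a).add hlim).add (hc a))⟩
  have h1 : (c n : A) - a * p n = -(p n * a * p n - c n) + (p n * a - a * p n) * p n := by
    rw [sub_mul, mul_assoc a, (hp n).isIdempotentElem.eq]
    abel
  have h2 := hcd n
  rw [dist_eq_norm] at h2
  have h3 := norm_mul_le (p n * a - a * p n) (p n)
  rw [h1]
  refine (norm_add_le _ _).trans ?_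
  have h4 := mul_le_of_le_one_right (norm_nonneg (p n * a - a * p n)) (hp1 n)
  rw [norm_neg]
  rw [one_div] at h2
  linarith

/-! ### Minimality of the `C⋆`-norm -/

/-- A faithful submultiplicative function dominated by the norm of a `C⋆`-algebra is the norm. -/
lemma eq_norm_of_submultiplicative {A : Type*} [CStarAlgebra A] [PartialOrder A]
    [StarOrderedRing A] [Nontrivial A] {N : A → ℝ} (h0 : ∀ x, 0 ≤ N x) (hle : ∀ x, N x ≤ ‖x‖)
    (hmul : ∀ x y, N (x * y) ≤ N x * N y) (hz : ∀ x, N x = 0 → x = 0) (v : A) : N v = ‖v‖ := by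
  have hpos : ∀ a : A, 0 ≤ a → ‖a‖ ≤ N a := by
    intro a ha
    by_contra! hlt
    obtain ⟨s, hs1, hs2⟩ := exists_between hlt
    have hs0 : 0 < s := (h0 a).trans_lt hs1
    have hpow : ∀ k, N (a ^ k) ≤ N a ^ k := by
      intro k
      induction k with
      | zero => simpa using hle 1
      | succ k ih =>
        rw [pow_succ, pow_succ]
        exact (hmul _ _).trans (mul_le_mul_of_nonneg_right ih (h0 _))
    -- The element `(a - s)_+` is divisible by every power of `a`: it equals `a ^ k` times a
    -- function of `a` of norm at most `‖a‖ / s ^ k`. So `N` of it is at most `(N a / s) ^ k * ‖a‖`,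
    -- which tends to `0`. Faithfulness forces `(a - s)_+ = 0`, contradicting `s < ‖a‖`.
    let f : ℝ → ℝ := fun t => max (t - s) 0
    have hf : Continuous f := by fun_prop
    have hh : ∀ k : ℕ, Continuous fun t : ℝ => f t / (max t s) ^ k := fun k =>
      hf.div (by fun_prop) fun t => (pow_pos (lt_max_of_lt_right hs0) k).ne'
    have hspec : ∀ t ∈ spectrum ℝ a, 0 ≤ t ∧ t ≤ ‖a‖ := fun t ht =>
      ⟨spectrum_nonneg_of_nonneg ha ht, (Real.le_norm_self t).trans (spectrum.norm_le_norm_of_mem ht)⟩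
    have hNb : ∀ k : ℕ, N (cfc f a) ≤ (N a / s) ^ k * ‖a‖ := by
      intro k
      have h1 : cfc f a = a ^ k * cfc (fun t : ℝ => f t / (max t s) ^ k) a := by
        conv_rhs => rw [← cfc_pow_id (R := ℝ) a k,
          ← cfc_mul (fun t : ℝ => t ^ k) _ a (by fun_prop) (hh k).continuousOn]
        refine cfc_congr fun t ht => ?_
        rcases le_total t s with h | h
        · simp [f, max_eq_right (sub_nonpos.2 h)]
        · have : t ≠ 0 := (hs0.trans_le h).ne'
          simp only [max_eq_left h]
          field_simp
      have h2 : ‖cfc (fun t : ℝ => f t / (max t s) ^ k) a‖ ≤ ‖a‖ / s ^ k := by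
        refine norm_cfc_le (by positivity) fun t ht => ?_
        have := hspec t ht
        have h3 : 0 ≤ f t := le_max_right _ _
        have h4 : f t ≤ ‖a‖ := max_le (by linarith) (norm_nonneg _)
        rw [Real.norm_of_nonneg (by positivity)]
        exact div_le_div₀ (norm_nonneg _) h4 (by positivity)
          (pow_le_pow_left₀ hs0.le (le_max_right _ _) k)
      calc N (cfc f a) ≤ N (a ^ k) * N (cfc (fun t : ℝ => f t / (max t s) ^ k) a) := by
            conv_lhs => rw [h1]
            exact hmul _ _
        _ ≤ N a ^ k * (‖a‖ / s ^ k) :=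
            mul_le_mul (hpow k) ((hle _).trans h2) (h0 _) (pow_nonneg (h0 _) _)
        _ = (N a / s) ^ k * ‖a‖ := by rw [div_pow]; ring
    have hlim : Tendsto (fun k : ℕ => (N a / s) ^ k * ‖a‖) atTop (𝓝 0) := by
      simpa using (tendsto_pow_atTop_nhds_zero_of_lt_one (div_nonneg (h0 a) hs0.le)
        ((div_lt_one hs0).2 hs1)).mul_const ‖a‖
    have hb : cfc f a = 0 := hz _ (le_antisymm (ge_of_tendsto' hlim hNb) (h0 _))
    have h5 : ‖f ‖a‖‖ ≤ ‖cfc f a‖ :=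
      norm_apply_le_norm_cfc f a (CStarAlgebra.norm_mem_spectrum_of_nonneg ha)
    rw [hb, norm_zero, Real.norm_of_nonneg (le_max_right _ _)] at h5
    have h6 : ‖a‖ - s ≤ f ‖a‖ := le_max_left _ _
    linarith
  refine le_antisymm (hle v) ?_
  rcases (norm_nonneg v).eq_or_lt with h | h
  · rw [← h]; exact h0 v
  have h1 := (hpos _ (star_mul_self_nonneg v)).trans (hmul _ _)
  rw [CStarRing.norm_star_mul_self] at h1
  have h2 : N (star v) ≤ ‖v‖ := (hle _).trans (norm_star v).le
  have h3 : ‖v‖ * ‖v‖ ≤ ‖v‖ * N v := h1.trans (mul_le_mul_of_nonneg_right h2 (h0 _))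
  exact le_of_mul_le_mul_left h3 h

/-! ### The asymptotic homomorphism and the MF property -/

namespace CornerSystem

variable {A : Type*} [CStarAlgebra A] (S : CornerSystem A)

/-- The sequence `c_n ∈ C_n` is asymptotically the compression of `a` to the corners. -/
def Represents (a : A) (c : ∀ n, S.C n) : Prop :=
  Tendsto (fun n => ‖(c n : A) - a * S.p n‖) atTop (𝓝 0)

/-- The unit of `C_n`. -/
def unit (n : ℕ) : S.C n := ⟨S.p n, S.mem n⟩

lemma norm_p_le (n : ℕ) : ‖S.p n‖ ≤ 1 := (S.isProj n).norm_le_one'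

lemma norm_rho_le (n : ℕ) (c : S.C n) : ‖S.ρ n c‖ ≤ ‖c‖ := by
  have := S.closed n
  exact NonUnitalStarAlgHom.norm_apply_le (S.ρ n) c

lemma norm_rho_unit (n : ℕ) : ‖S.ρ n (S.unit n)‖ = 1 := by
  have h1 : star (S.unit n) * S.unit n = S.unit n := Subtype.ext <| by
    change star (S.p n) * S.p n = S.p n
    rw [(S.isProj n).isSelfAdjoint.star_eq, (S.isProj n).isIdempotentElem.eq]
  have h2 : ‖S.ρ n (S.unit n)‖ * ‖S.ρ n (S.unit n)‖ = ‖S.ρ n (S.unit n)‖ := by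
    rw [← CStarRing.norm_star_mul_self, ← map_star, ← map_mul, h1]
  have h3 : ‖S.ρ n (S.unit n)‖ ≠ 0 := norm_ne_zero_iff.2 (S.ρ_ne n)
  exact mul_left_cancel₀ h3 (by rw [h2, mul_one])

variable {S}

lemma Represents.tendsto {a : A} {c : ∀ n, S.C n} (hc : S.Represents a c) :
    Tendsto (fun n => ‖(c n : A) - a * S.p n‖) atTop (𝓝 0) := hc

lemma represents_one : S.Represents 1 S.unit := by
  simp [Represents, unit]

lemma Represents.norm_le {a : A} {c : ∀ n, S.C n} (n : ℕ) :
    ‖c n‖ ≤ ‖a‖ + ‖(c n : A) - a * S.p n‖ := by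
  have h1 : (c n : A) = a * S.p n + ((c n : A) - a * S.p n) := by abel
  have h2 : ‖(c n : A)‖ ≤ ‖a * S.p n‖ + ‖(c n : A) - a * S.p n‖ := by
    conv_lhs => rw [h1]
    exact norm_add_le _ _
  have h3 : ‖a * S.p n‖ ≤ ‖a‖ :=
    (norm_mul_le _ _).trans (mul_le_of_le_one_right (norm_nonneg _) (S.norm_p_le n))
  exact h2.trans (by gcongr)

lemma Represents.add {a b : A} {c d : ∀ n, S.C n} (hc : S.Represents a c)
    (hd : S.Represents b d) : S.Represents (a + b) (c + d) := by
  refine squeeze_zero (fun _ => norm_nonneg _) (fun n => ?_) (by simpa using hc.tendsto.add hd.tendsto)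
  have : (((c + d) n : S.C n) : A) - (a + b) * S.p n
      = ((c n : A) - a * S.p n) + ((d n : A) - b * S.p n) := by
    rw [Pi.add_apply, AddMemClass.coe_add]; noncomm_ring
  rw [this]
  exact norm_add_le _ _

lemma Represents.smul {a : A} {c : ∀ n, S.C n} (z : ℂ) (hc : S.Represents a c) :
    S.Represents (z • a) (z • c) := by
  refine squeeze_zero (fun _ => norm_nonneg _) (fun n => ?_) (by simpa using hc.const_mul ‖z‖)
  have : (((z • c) n : S.C n) : A) - (z • a) * S.p n = z • ((c n : A) - a * S.p n) := by
    simp [smul_sub]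
  rw [this, norm_smul]

lemma Represents.neg {a : A} {c : ∀ n, S.C n} (hc : S.Represents a c) :
    S.Represents (-a) (-c) := by
  simpa using hc.smul (-1)

lemma Represents.sub {a b : A} {c d : ∀ n, S.C n} (hc : S.Represents a c)
    (hd : S.Represents b d) : S.Represents (a - b) (c - d) := by
  simpa [sub_eq_add_neg] using hc.add hd.neg

lemma Represents.star {a : A} {c : ∀ n, S.C n} (hc : S.Represents a c) :
    S.Represents (star a) (star c) := by
  refine squeeze_zero (fun _ => norm_nonneg _) (fun n => ?_)
    (by simpa using hc.tendsto.add (S.comm (Star.star a)))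
  have h : (((Star.star c) n : S.C n) : A) - Star.star a * S.p n
      = Star.star ((c n : A) - a * S.p n) + (S.p n * Star.star a - Star.star a * S.p n) := by
    simp [(S.isProj n).isSelfAdjoint.star_eq]
  rw [h]
  exact (norm_add_le _ _).trans (by rw [norm_star])

/-- This is where asymptotic centrality is essential: `a p_n b p_n` and `a b p_n` differ by `a (p_n
b - b p_n) p_n`. -/
lemma Represents.mul {a b : A} {c d : ∀ n, S.C n} (hc : S.Represents a c)
    (hd : S.Represents b d) : S.Represents (a * b) (c * d) := by
  have hlim : Tendsto (fun n => (‖a‖ + ‖(c n : A) - a * S.p n‖) * ‖(d n : A) - b * S.p n‖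
      + ‖(c n : A) - a * S.p n‖ * ‖b‖ + ‖a‖ * ‖S.p n * b - b * S.p n‖) atTop (𝓝 0) := by
    simpa using (((hc.const_add ‖a‖).mul hd).add (hc.mul_const ‖b‖)).add
      ((S.comm b).const_mul ‖a‖)
  refine squeeze_zero (fun _ => norm_nonneg _) (fun n => ?_) hlim
  have h : (((c * d) n : S.C n) : A) - a * b * S.p n
      = (c n : A) * ((d n : A) - b * S.p n) + ((c n : A) - a * S.p n) * (b * S.p n)
        + a * (S.p n * b - b * S.p n) * S.p n := by
    simp only [Pi.mul_apply, MulMemClass.coe_mul]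
    have := (S.isProj n).isIdempotentElem.eq
    have e1 : a * (S.p n * b - b * S.p n) * S.p n
        = a * S.p n * (b * S.p n) - a * b * (S.p n * S.p n) := by noncomm_ring
    rw [e1, this]
    noncomm_ring
  have h1 : ‖b * S.p n‖ ≤ ‖b‖ :=
    (norm_mul_le _ _).trans (mul_le_of_le_one_right (norm_nonneg _) (S.norm_p_le n))
  rw [h]
  refine (norm_add₃_le).trans ?_
  gcongr
  · exact (norm_mul_le _ _).trans (by gcongr; exact Represents.norm_le n)
  · exact (norm_mul_le _ _).trans (by gcongr)
  · refine (norm_mul_le _ _).trans ?_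
    exact (mul_le_of_le_one_right (norm_nonneg _) (S.norm_p_le n)).trans (norm_mul_le _ _)

lemma Represents.norm_sub_tendsto {a : A} {c d : ∀ n, S.C n} (hc : S.Represents a c)
    (hd : S.Represents a d) : Tendsto (fun n => ‖c n - d n‖) atTop (𝓝 0) := by
  have := hc.sub hd
  simpa [Represents] using this

lemma Represents.rho_tendsto {a : A} {c d : ∀ n, S.C n} (hc : S.Represents a c)
    (hd : S.Represents a d) : Tendsto (fun n => ‖S.ρ n (c n) - S.ρ n (d n)‖) atTop (𝓝 0) :=
  squeeze_zero (fun _ => norm_nonneg _)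
    (fun n => by rw [← map_sub]; exact S.norm_rho_le n _) (hc.norm_sub_tendsto hd)

variable (S)

/-- A chosen sequence representing `a`. -/
noncomputable def lift (a : A) : ∀ n, S.C n := (S.approx a).choose

lemma represents_lift (a : A) : S.Represents a (S.lift a) := (S.approx a).choose_spec

/-- The closed two-sided ideal of the elements which vanish asymptotically along `l`. -/
noncomputable def nullIdeal (l : Filter ℕ) (hl : l ≤ atTop) : TwoSidedIdeal A :=
  TwoSidedIdeal.mk' {a | ∃ c, S.Represents a c ∧ Tendsto (fun n => ‖S.ρ n (c n)‖) l (𝓝 0)}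
    ⟨0, by simp [Represents], by simp [tendsto_const_nhds]⟩
    (by
      rintro a b ⟨c, hc, hc'⟩ ⟨d, hd, hd'⟩
      refine ⟨c + d, hc.add hd, squeeze_zero (fun _ => norm_nonneg _) (fun n => ?_)
        (by simpa using hc'.add hd')⟩
      rw [Pi.add_apply, map_add]
      exact norm_add_le _ _)
    (by
      rintro a ⟨c, hc, hc'⟩
      exact ⟨-c, hc.neg, by simpa using hc'⟩)
    (by
      rintro a b ⟨d, hd, hd'⟩
      refine ⟨S.lift a * d, (S.represents_lift a).mul hd,
        squeeze_zero (fun _ => norm_nonneg _) (fun n => ?_) (by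
          simpa using (((S.represents_lift a).const_add ‖a‖).mono_left hl).mul hd')⟩
      rw [Pi.mul_apply, map_mul]
      refine (norm_mul_le _ _).trans (mul_le_mul_of_nonneg_right ?_ (norm_nonneg _))
      exact (S.norm_rho_le n _).trans (Represents.norm_le n))
    (by
      rintro a b ⟨c, hc, hc'⟩
      refine ⟨c * S.lift b, hc.mul (S.represents_lift b),
        squeeze_zero (fun _ => norm_nonneg _) (fun n => ?_) (by
          simpa using hc'.mul (((S.represents_lift b).const_add ‖b‖).mono_left hl))⟩
      rw [Pi.mul_apply, map_mul]
      refine (norm_mul_le _ _).trans (mul_le_mul_of_nonneg_left ?_ (norm_nonneg _))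
      exact (S.norm_rho_le n _).trans (Represents.norm_le n))

lemma mem_nullIdeal {l : Filter ℕ} {hl : l ≤ atTop} {a : A} : a ∈ S.nullIdeal l hl ↔
    ∃ c, S.Represents a c ∧ Tendsto (fun n => ‖S.ρ n (c n)‖) l (𝓝 0) := by
  rw [nullIdeal, TwoSidedIdeal.mem_mk']
  rfl

lemma isClosed_nullIdeal (l : Filter ℕ) (hl : l ≤ atTop) :
    IsClosed (S.nullIdeal l hl : Set A) := by
  refine isClosed_of_closure_subset fun a ha => ?_
  rw [SetLike.mem_coe, mem_nullIdeal]
  refine ⟨S.lift a, S.represents_lift a, ?_⟩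
  rw [Metric.tendsto_nhds]
  intro ε hε
  obtain ⟨b, hb, hab⟩ := Metric.mem_closure_iff.1 ha (ε / 3) (by positivity)
  rw [SetLike.mem_coe, mem_nullIdeal] at hb
  obtain ⟨d, hd, hd'⟩ := hb
  have h1 := (((S.represents_lift a).sub hd).mono_left hl).eventually_lt_const
    (show (0 : ℝ) < ε / 3 by positivity)
  have h2 := hd'.eventually_lt_const (show (0 : ℝ) < ε / 3 by positivity)
  filter_upwards [h1, h2] with n h1 h2
  rw [dist_eq_norm] at hab
  rw [Real.dist_eq, sub_zero, abs_of_nonneg (norm_nonneg _)]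
  have h3 : ‖S.ρ n (S.lift a n)‖ ≤ ‖S.ρ n ((S.lift a - d) n)‖ + ‖S.ρ n (d n)‖ := by
    rw [Pi.sub_apply, map_sub]
    exact norm_le_norm_sub_add _ _
  have h4 := (S.norm_rho_le n ((S.lift a - d) n)).trans (Represents.norm_le (a := a - b) n)
  linarith

variable {S}

/-- If `A` is simple, only zero vanishes asymptotically. -/
lemma eq_zero_of_tendsto (hA : IsSimpleCStar A) {l : Filter ℕ} [l.NeBot] (hl : l ≤ atTop) {a : A}
    {c : ∀ n, S.C n} (hc : S.Represents a c) (h : Tendsto (fun n => ‖S.ρ n (c n)‖) l (𝓝 0)) :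
    a = 0 := by
  rcases hA.2 _ (S.isClosed_nullIdeal l hl) with h1 | h1
  · have : a ∈ S.nullIdeal l hl := S.mem_nullIdeal.2 ⟨c, hc, h⟩
    rw [h1] at this
    simpa using this
  · exfalso
    -- The unit is represented by `p_n`, whose image has norm `1` for every `n`, so it cannot be
    -- null.
    have : (1 : A) ∈ S.nullIdeal l hl := by rw [h1]; trivial
    obtain ⟨d, hd, hd'⟩ := S.mem_nullIdeal.1 this
    have h2 := (represents_one.rho_tendsto hd).mono_left hl
    have h3 := h2.add hd'
    rw [add_zero] at h3
    refine absurd (ge_of_tendsto' h3 (b := 1) fun n => ?_) (by norm_num)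
    rw [← S.norm_rho_unit n]
    exact norm_le_norm_sub_add _ _

/-- The representations are asymptotically isometric along an ultrafilter. -/
lemma Represents.tendsto_norm_rho [PartialOrder A] [StarOrderedRing A] (hA : IsSimpleCStar A)
    {l : Ultrafilter ℕ} (hl : (l : Filter ℕ) ≤ atTop) {a : A}
    {c : ∀ n, S.C n} (hc : S.Represents a c) :
    Tendsto (fun n => ‖S.ρ n (c n)‖) l (𝓝 ‖a‖) := by
  have := hA.1
  -- The ultralimit `N a` of the norms exists because they are eventually at most `‖a‖ + 1`. It is
  -- submultiplicative, bounded by the norm and faithful by simplicity, hence it is the norm.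
  have hex : ∀ a, ∃ r, Tendsto (fun n => ‖S.ρ n (S.lift a n)‖) l (𝓝 r) := by
    intro a
    have hb := ((S.represents_lift a).mono_left hl).eventually_lt_const zero_lt_one
    obtain ⟨r, -, hr⟩ := (isCompact_Icc (a := (0 : ℝ)) (b := ‖a‖ + 1)).ultrafilter_le_nhds
      (l.map fun n => ‖S.ρ n (S.lift a n)‖) (by
        rw [Ultrafilter.coe_map, le_principal_iff]
        change ∀ᶠ n in (l : Filter ℕ), _
        filter_upwards [hb] with n hn
        exact ⟨norm_nonneg _, (S.norm_rho_le n _).trans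
          ((Represents.norm_le (a := a) n).trans (by gcongr))⟩)
    exact ⟨r, hr⟩
  choose N hN using hex
  have hN' : ∀ {a : A} {c : ∀ n, S.C n}, S.Represents a c →
      Tendsto (fun n => ‖S.ρ n (c n)‖) l (𝓝 (N a)) := by
    intro a c hc
    have h1 := (hc.rho_tendsto (S.represents_lift a)).mono_left hl
    refine (hN a).congr_dist (squeeze_zero (fun _ => dist_nonneg) (fun n => ?_) h1)
    rw [Real.dist_eq, norm_sub_rev]
    exact abs_norm_sub_norm_le _ _
  have hNa : ∀ a, N a = ‖a‖ := by
    refine eq_norm_of_submultiplicative (fun a => ge_of_tendsto' (hN a) fun _ => norm_nonneg _)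
      (fun a => ?_) (fun a b => ?_) (fun a ha => ?_)
    · have h1 := ((S.represents_lift a).const_add ‖a‖).mono_left hl
      rw [add_zero] at h1
      exact le_of_tendsto_of_tendsto' (hN a) h1 fun n =>
        (S.norm_rho_le n _).trans (Represents.norm_le n)
    · refine le_of_tendsto_of_tendsto' (hN' ((S.represents_lift a).mul (S.represents_lift b)))
        ((hN a).mul (hN b)) fun n => ?_
      rw [Pi.mul_apply, map_mul]
      exact norm_mul_le _ _
    · have := hN a
      rw [ha] at this
      exact eq_zero_of_tendsto hA hl (S.represents_lift a) this
  rw [← hNa]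
  exact hN' hc

/-- Matrices as operators on a Euclidean space. -/
noncomputable def matrixEquiv (m : ℕ) : (EuclideanSpace ℂ (Fin m) →L[ℂ] EuclideanSpace ℂ (Fin m))
    ≃⋆ₐ[ℂ] CStarMatrix (Fin m) (Fin m) ℂ :=
  (Matrix.toEuclideanCLM (𝕜 := ℂ) (n := Fin m)).symm.trans CStarMatrix.ofMatrixStarAlgEquiv

lemma norm_matrixEquiv (m : ℕ) (x : EuclideanSpace ℂ (Fin m) →L[ℂ] EuclideanSpace ℂ (Fin m)) :
    ‖matrixEquiv m x‖ = ‖x‖ :=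
  StarAlgEquiv.norm_map (F := (EuclideanSpace ℂ (Fin m) →L[ℂ] EuclideanSpace ℂ (Fin m))
    ≃⋆ₐ[ℂ] CStarMatrix (Fin m) (Fin m) ℂ) (matrixEquiv m) x

/-- The representation `ρ_n`, by matrices. -/
noncomputable def σ (S : CornerSystem A) (n : ℕ) :
    S.C n →⋆ₙₐ[ℂ] CStarMatrix (Fin (S.k n + 1)) (Fin (S.k n + 1)) ℂ :=
  NonUnitalStarAlgHom.comp (matrixEquiv (S.k n + 1) :
    (EuclideanSpace ℂ (Fin (S.k n + 1)) →L[ℂ] EuclideanSpace ℂ (Fin (S.k n + 1)))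
    →⋆ₙₐ[ℂ] CStarMatrix (Fin (S.k n + 1)) (Fin (S.k n + 1)) ℂ) (S.ρ n)

lemma norm_sigma (S : CornerSystem A) (n : ℕ) (c : S.C n) : ‖S.σ n c‖ = ‖S.ρ n c‖ :=
  norm_matrixEquiv _ _

lemma memlp_lift (S : CornerSystem A) (a : A) :
    Memℓp (E := fun n => CStarMatrix (Fin (S.k n + 1)) (Fin (S.k n + 1)) ℂ)
      (fun n => S.σ n (S.lift a n)) ∞ := by
  refine memℓp_infty ?_
  obtain ⟨K, hK⟩ := (S.represents_lift a).bddAbove_range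
  refine ⟨‖a‖ + K, ?_⟩
  rintro _ ⟨n, rfl⟩
  change ‖S.σ n (S.lift a n)‖ ≤ _
  rw [norm_sigma]
  refine (S.norm_rho_le n _).trans ((Represents.norm_le (a := a) n).trans ?_)
  gcongr
  exact hK ⟨n, rfl⟩

/-- A simple algebra with a corner system is MF. -/
lemma isMF (S : CornerSystem A) (hA : IsSimpleCStar A) : IsMF A := by
  let B : ℕ → Type := fun n => CStarMatrix (Fin (S.k n + 1)) (Fin (S.k n + 1)) ℂ
  let F : A → lp B ∞ := fun a => ⟨_, S.memlp_lift a⟩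
  have hF : ∀ a n, F a n = S.σ n (S.lift a n) := fun _ _ => rfl
  -- Modulo null sequences the image of `a` does not depend on the representing sequence. Each
  -- homomorphism law therefore reduces to the corresponding closure property of `Represents`.
  have key : ∀ (x : lp B ∞) (a : A) (c : ∀ n, S.C n), S.Represents a c →
      (∀ n, x n = S.σ n (c n)) →
      (Ideal.Quotient.mk (c0Ideal B) (F a) : ProdModSum B) = Ideal.Quotient.mk (c0Ideal B) x := by
    intro x a c hc hx
    rw [Ideal.Quotient.eq]
    change Tendsto (fun n => ‖(F a - x) n‖) atTop (𝓝 0)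
    refine ((S.represents_lift a).rho_tendsto hc).congr fun n => ?_
    rw [lp.coeFn_sub, Pi.sub_apply, hF, hx, ← map_sub (S.ρ n), ← map_sub (S.σ n)]
    exact (S.norm_sigma n _).symm
  let φ : A →⋆ₙₐ[ℂ] ProdModSum B :=
    { toFun := fun a => Ideal.Quotient.mk (c0Ideal B) (F a)
      map_smul' := fun z a => by
        refine key (z • F a) _ _ ((S.represents_lift a).smul z) fun n => ?_
        rw [lp.coeFn_smul, Pi.smul_apply, hF, Pi.smul_apply, map_smul]
      map_zero' := key 0 0 0 (by simp [Represents]) fun n => by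
        rw [Pi.zero_apply, map_zero]; rfl
      map_add' := fun a b => by
        refine (key (F a + F b) _ _ ((S.represents_lift a).add (S.represents_lift b))
          fun n => ?_).trans (RingHom.map_add _ _ _)
        rw [lp.coeFn_add, Pi.add_apply, hF, hF, Pi.add_apply, map_add]
      map_mul' := fun a b => by
        refine (key (F a * F b) _ _ ((S.represents_lift a).mul (S.represents_lift b))
          fun n => ?_).trans (RingHom.map_mul _ _ _)
        rw [lp.infty_coeFn_mul, Pi.mul_apply, hF, hF, Pi.mul_apply, map_mul]
      map_star' := fun a => by
        rw [ProdModSum.star_mk]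
        refine key _ _ _ (S.represents_lift a).star fun n => ?_
        rw [lp.star_apply, hF, Pi.star_apply, map_star] }
  refine ⟨S.k, φ, ?_⟩
  rw [injective_iff_map_eq_zero]
  intro a ha
  have h1 : (Ideal.Quotient.mk (c0Ideal B) (F a) : ProdModSum B) = 0 := ha
  rw [Ideal.Quotient.eq_zero_iff_mem] at h1
  refine eq_zero_of_tendsto hA le_rfl (S.represents_lift a) ?_
  refine (show Tendsto (fun n => ‖F a n‖) atTop (𝓝 0) from h1).congr fun n => ?_
  rw [hF]
  exact S.norm_sigma n _

end CornerSystem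

/-! ### States: compactness, positivity and extension -/

section States

/-- The states of a unital `C⋆`-algebra, with the weak-* topology. -/
def stateSpace (A : Type*) [CStarAlgebra A] [PartialOrder A] : Set (WeakDual ℂ A) :=
  {φ | φ 1 = 1 ∧ ∀ a, 0 ≤ a → 0 ≤ φ a}

variable {A : Type*} [CStarAlgebra A] [PartialOrder A]

lemma convex_stateSpace : Convex ℝ (stateSpace A) := by
  intro φ hφ ψ hψ a b ha hb hab
  refine ⟨?_, fun x hx => ?_⟩
  · change a • φ 1 + b • ψ 1 = 1
    rw [hφ.1, hψ.1, ← add_smul, hab, one_smul]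
  · change 0 ≤ a • φ x + b • ψ x
    exact add_nonneg (smul_nonneg ha (hφ.2 x hx)) (smul_nonneg hb (hψ.2 x hx))

lemma isClosed_stateSpace : IsClosed (stateSpace A) := by
  have : stateSpace A = {φ | φ 1 = 1} ∩ ⋂ a, ⋂ (_ : 0 ≤ a), {φ | 0 ≤ φ a} := by
    ext φ; simp [stateSpace]
  rw [this]
  exact (isClosed_eq (WeakDual.eval_continuous _) continuous_const).inter
    (isClosed_iInter fun a => isClosed_iInter fun _ =>
      isClosed_le continuous_const (WeakDual.eval_continuous a))

variable [StarOrderedRing A]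

/-- A state as a positive linear map. -/
noncomputable def positiveOfState {φ : WeakDual ℂ A} (hφ : φ ∈ stateSpace A) : A →ₚ[ℂ] ℂ :=
  PositiveLinearMap.mk₀ (WeakDual.toStrongDual φ : A →ₗ[ℂ] ℂ) hφ.2

lemma state_norm_sq {φ : WeakDual ℂ A} (hφ : φ ∈ stateSpace A) (a : A) :
    ((‖(positiveOfState hφ).toPreGNS a‖ ^ 2 : ℝ) : ℂ) = φ (star a * a) := by
  rw [Complex.ofReal_pow]
  exact (positiveOfState hφ).preGNS_norm_sq _

lemma state_norm_eq {φ : WeakDual ℂ A} (hφ : φ ∈ stateSpace A) (a : A) :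
    ‖(positiveOfState hφ).toPreGNS a‖ = √(φ (star a * a)).re := by
  rw [← state_norm_sq hφ, Complex.ofReal_re, Real.sqrt_sq (norm_nonneg _)]

lemma state_star_mul_self_le {φ : WeakDual ℂ A} (hφ : φ ∈ stateSpace A) (a : A) :
    (φ (star a * a)).re ≤ ‖a‖ ^ 2 := by
  have h1 : (0 : A) ≤ algebraMap ℝ A (‖a‖ ^ 2) - star a * a :=
    sub_nonneg.2 CStarAlgebra.star_mul_le_algebraMap_norm_sq
  have h2 := hφ.2 _ h1
  rw [map_sub, Algebra.algebraMap_eq_smul_one, ← Complex.coe_smul, map_smul, hφ.1] at h2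
  have h3 := (Complex.le_def.1 h2).1
  simpa [← Complex.ofReal_pow] using h3

lemma state_norm_le_norm {φ : WeakDual ℂ A} (hφ : φ ∈ stateSpace A) (a : A) :
    ‖(positiveOfState hφ).toPreGNS a‖ ≤ ‖a‖ := by
  rw [state_norm_eq]
  exact Real.sqrt_le_iff.2 ⟨norm_nonneg _, state_star_mul_self_le hφ a⟩

lemma state_cauchy_schwarz {φ : WeakDual ℂ A} (hφ : φ ∈ stateSpace A) (a b : A) :
    ‖φ (star a * b)‖ ≤ √(φ (star a * a)).re * √(φ (star b * b)).re := by
  rw [← state_norm_eq hφ, ← state_norm_eq hφ]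
  exact norm_inner_le_norm (𝕜 := ℂ) ((positiveOfState hφ).toPreGNS a)
    ((positiveOfState hφ).toPreGNS b)

lemma state_norm_apply_le {φ : WeakDual ℂ A} (hφ : φ ∈ stateSpace A) (a : A) : ‖φ a‖ ≤ ‖a‖ := by
  have h1 := state_cauchy_schwarz hφ 1 a
  rw [star_one, one_mul, one_mul, hφ.1, Complex.one_re, Real.sqrt_one, one_mul,
    ← state_norm_eq hφ] at h1
  exact h1.trans (state_norm_le_norm hφ a)

lemma state_map_star {φ : WeakDual ℂ A} (hφ : φ ∈ stateSpace A) (a : A) :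
    φ (star a) = star (φ a) := map_star (positiveOfState hφ) a

lemma isCompact_stateSpace : IsCompact (stateSpace A) := by
  refine (WeakDual.isCompact_closedBall (𝕜 := ℂ) (0 : StrongDual ℂ A) 1).of_isClosed_subset
    isClosed_stateSpace fun φ hφ => ?_
  rw [Set.mem_preimage, mem_closedBall_zero_iff]
  exact ContinuousLinearMap.opNorm_le_bound _ zero_le_one fun a => by
    rw [one_mul]; exact state_norm_apply_le hφ a

lemma exists_tendsto_state {φ : ℕ → WeakDual ℂ A} (hφ : ∀ n, φ n ∈ stateSpace A)
    (l : Ultrafilter ℕ) : ∃ ψ ∈ stateSpace A, Tendsto φ l (𝓝 ψ) := by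
  obtain ⟨ψ, hψ, h⟩ := isCompact_stateSpace.ultrafilter_le_nhds (l.map φ)
    (by
      rw [Ultrafilter.coe_map, le_principal_iff, mem_map]
      exact Filter.univ_mem' hφ)
  exact ⟨ψ, hψ, h⟩

/-- A contractive functional with `φ(1) = 1` is a state. -/
lemma mem_stateSpace_of_norm_le [Nontrivial A] {φ : WeakDual ℂ A} (h1 : φ 1 = 1)
    (hle : ∀ a, ‖φ a‖ ≤ ‖a‖) :
    φ ∈ stateSpace A := by
  refine ⟨h1, fun a ha => ?_⟩
  have hsa : star a = a := ha.isSelfAdjoint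
  rw [Complex.le_def]
  refine ⟨?_, ?_⟩
  · have h2 : ‖(‖a‖ : ℂ) • (1 : A) - a‖ ≤ ‖a‖ := by
      have e : (‖a‖ : ℂ) • (1 : A) = algebraMap ℝ A ‖a‖ := by
        rw [Algebra.algebraMap_eq_smul_one, ← Complex.coe_smul]
      rw [e]
      have h3 : (0 : A) ≤ algebraMap ℝ A ‖a‖ - a :=
        sub_nonneg.2 (IsSelfAdjoint.le_algebraMap_norm_self hsa)
      refine (CStarAlgebra.norm_le_norm_of_nonneg_of_le h3 (sub_le_self _ ha)).trans ?_
      rw [norm_algebraMap', norm_norm]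
    have h3 := (hle _).trans h2
    rw [map_sub, map_smul, h1, smul_eq_mul, mul_one] at h3
    have h4 := (Complex.re_le_norm _).trans h3
    rw [Complex.sub_re, Complex.ofReal_re] at h4
    rw [Complex.zero_re]
    linarith
  -- Evaluating at `a + i t` and using `‖a + i t‖ ^ 2 ≤ ‖a‖ ^ 2 + t ^ 2` bounds `2 t Im φ(a)` for
  -- all real `t`, which is possible only if the imaginary part vanishes.
  · have h2 : ∀ t : ℝ, ((φ a).im + t) ^ 2 ≤ ‖a‖ ^ 2 + t ^ 2 := by
      intro t
      set z : ℂ := t * Complex.I with hz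
      have e1 : star (a + z • (1 : A)) * (a + z • 1) = a * a + ((t ^ 2 : ℝ) : ℂ) • 1 := by
        have hz1 : star z = -z := by simp [hz]
        have hz2 : z * z = -((t ^ 2 : ℝ) : ℂ) := by
          rw [hz]; push_cast; linear_combination (t : ℂ) ^ 2 * Complex.I_mul_I
        rw [star_add, star_smul, star_one, hsa, hz1]
        simp only [add_mul, mul_add, smul_mul_assoc, mul_smul_comm, one_mul, mul_one, smul_smul,
          smul_add, neg_mul, smul_neg, hz2, neg_neg, neg_smul]
        abel
      have e2 : ‖a + z • (1 : A)‖ ^ 2 ≤ ‖a‖ ^ 2 + t ^ 2 := by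
        rw [sq, ← CStarRing.norm_star_mul_self, e1]
        refine (norm_add_le _ _).trans ?_
        have e3 : ‖((t ^ 2 : ℝ) : ℂ) • (1 : A)‖ ≤ t ^ 2 := by
          rw [norm_smul, Complex.norm_real, Real.norm_of_nonneg (sq_nonneg t)]
          rw [norm_one, mul_one]
        have e4 := norm_mul_le a a
        nlinarith
      have e5 : ((φ a).im + t) ^ 2 ≤ ‖φ (a + z • 1)‖ ^ 2 := by
        have : (φ (a + z • 1)).im = (φ a).im + t := by
          rw [map_add, map_smul, h1, Complex.add_im]
          simp [hz]
        rw [← this, ← sq_abs]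
        exact pow_le_pow_left₀ (abs_nonneg _) (Complex.abs_im_le_norm _) 2
      exact e5.trans ((pow_le_pow_left₀ (norm_nonneg _) (hle _) 2).trans e2)
    by_contra hne
    have hne' : (φ a).im ≠ 0 := fun h => hne h.symm
    -- This `t` makes the cross term `2 t Im φ(a)` equal to `‖a‖ ^ 2 + 1`, exceeding the allowed
    -- `‖a‖ ^ 2`.
    have h3 := h2 ((‖a‖ ^ 2 + 1) / (2 * (φ a).im))
    have h4 : 2 * (φ a).im * ((‖a‖ ^ 2 + 1) / (2 * (φ a).im)) = ‖a‖ ^ 2 + 1 := by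
      field_simp
    nlinarith [sq_nonneg (φ a).im]

/-- Cauchy–Schwarz against `1 - p`, which has `φ`-norm zero. -/
lemma state_mul_proj {φ : WeakDual ℂ A} (hφ : φ ∈ stateSpace A) {p : A} (hp : IsStarProjection p)
    (h : φ p = 1) (a : A) : φ (a * p) = φ a := by
  have hq := hp.one_sub
  have h1 := state_cauchy_schwarz hφ (star a) (1 - p)
  rw [hq.isSelfAdjoint.star_eq, hq.isIdempotentElem.eq, map_sub, hφ.1, h, sub_self,
    Complex.zero_re, Real.sqrt_zero, mul_zero, star_star] at h1
  have h2 : φ (a * (1 - p)) = 0 := norm_le_zero_iff.1 h1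
  rw [mul_sub, mul_one, map_sub, sub_eq_zero] at h2
  exact h2.symm

/-- Hahn--Banach extension of states from a corner subalgebra. -/
lemma exists_state_extension [Nontrivial A] (C : NonUnitalStarSubalgebra ℂ A) {p : A} (hp : IsStarProjection p)
    (hpC : p ∈ C) (f : C →ₗ[ℂ] ℂ) (hf : ∀ c, ‖f c‖ ≤ ‖c‖) (hf1 : f ⟨p, hpC⟩ = 1) :
    ∃ φ ∈ stateSpace A, ∀ c : C, φ c = f c := by
  let V : Submodule ℂ A := C.toSubmodule
  let g : StrongDual ℂ V := LinearMap.mkContinuous (𝕜 := ℂ)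
    { toFun := fun c => f ⟨c.1, c.2⟩
      map_add' := fun a b => f.map_add ⟨a.1, a.2⟩ ⟨b.1, b.2⟩
      map_smul' := fun z a => f.map_smul z ⟨a.1, a.2⟩ } 1
    (fun c => by rw [one_mul]; exact hf ⟨c.1, c.2⟩)
  have hg : ‖g‖ ≤ 1 := LinearMap.mkContinuous_norm_le _ zero_le_one _
  obtain ⟨h, hh1, hh2⟩ := exists_extension_norm_eq V g
  have hle : ∀ a, ‖h a‖ ≤ ‖a‖ := fun a => by
    simpa using h.le_of_opNorm_le (hh2.trans_le hg) a
  have hext : ∀ c : C, h c = f c := fun c => hh1 ⟨c.1, c.2⟩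
  have hp1 : h p = 1 := by rw [← hf1]; exact hext ⟨p, hpC⟩
  -- If `h (1 - p) ≠ 0`, a unimodular `z` aligned with it makes `p + z (1 - p)` an isometry on which
  -- the contraction `h` takes the value `1 + ‖h (1 - p)‖ > 1`.
  have h0 : h (1 - p) = 0 := by
    by_contra hne
    set w := h (1 - p) with hw
    set z : ℂ := star w / ‖w‖ with hz
    have hw0 : (‖w‖ : ℂ) ≠ 0 := by simpa using hne
    have hzw : z * w = ‖w‖ := by
      rw [hz, div_mul_eq_mul_div, div_eq_iff hw0]
      have := Complex.conj_mul' w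
      rw [Complex.star_def, this, sq]
    have hzz : z * star z = 1 := by
      have : ‖z‖ = 1 := by
        rw [hz, norm_div, norm_star, Complex.norm_real, norm_norm, div_self]
        simpa using hne
      rw [Complex.star_def, Complex.mul_conj', this]; simp
    have hb : ‖p + z • (1 - p)‖ ≤ 1 := by
      have e : star (p + z • (1 - p)) * (p + z • (1 - p)) = 1 := by
        have hq := hp.one_sub
        have hpp := hp.isIdempotentElem.eq
        have e1 : p * (1 - p) = 0 := by rw [mul_sub, mul_one, hpp, sub_self]
        have e2 : (1 - p) * p = 0 := by rw [sub_mul, one_mul, hpp, sub_self]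
        rw [star_add, star_smul, hp.isSelfAdjoint.star_eq, hq.isSelfAdjoint.star_eq]
        simp only [add_mul, mul_add, smul_mul_assoc, mul_smul_comm, smul_smul,
          smul_add, hpp, e1, e2,
          hq.isIdempotentElem.eq, hzz, smul_zero, one_smul]
        abel
      have h2 : ‖p + z • (1 - p)‖ * ‖p + z • (1 - p)‖ ≤ 1 := by
        rw [← CStarRing.norm_star_mul_self, e, norm_one]
      nlinarith [norm_nonneg (p + z • (1 - p))]
    have h3 := (hle (p + z • (1 - p))).trans hb
    rw [map_add, map_smul, hp1, ← hw, smul_eq_mul, hzw] at h3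
    have h4 := (Complex.re_le_norm _).trans h3
    rw [Complex.add_re, Complex.one_re, Complex.ofReal_re] at h4
    have : 0 < ‖w‖ := norm_pos_iff.2 hne
    linarith
  have h1 : h 1 = 1 := by
    rw [map_sub, sub_eq_zero, hp1] at h0
    exact h0
  exact ⟨StrongDual.toWeakDual h, mem_stateSpace_of_norm_le h1 hle, hext⟩

end States

/-! ### Hahn–Banach separation in the weak-* topology -/

/-- In a topology defined by seminorms, points outside the closure of a convex set are separated
from it. -/
lemma WithSeminorms.exists_re_lt_of_notMem_closure {𝕜 E ι : Type*} [RCLike 𝕜] [AddCommGroup E]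
    [Module 𝕜 E] [TopologicalSpace E] [IsTopologicalAddGroup E] [ContinuousSMul 𝕜 E]
    {p : SeminormFamily 𝕜 E ι} (hp : WithSeminorms p) {s : Set E}
    (hs : ∀ φ ∈ s, ∀ ψ ∈ s, ∀ a b : ℝ, 0 ≤ a → 0 ≤ b →
      a + b = 1 → (a : 𝕜) • φ + (b : 𝕜) • ψ ∈ s) {x : E} (hx : x ∉ closure s) :
    ∃ (f : StrongDual 𝕜 E) (u : ℝ), (∀ φ ∈ s, RCLike.re (f φ) < u) ∧ u < RCLike.re (f x) := by
  let _ : Module ℝ E := Module.compHom E (algebraMap ℝ 𝕜)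
  have : IsScalarTower ℝ 𝕜 E := ⟨fun r c φ => by
    rw [RCLike.real_smul_eq_coe_mul, mul_smul]; rfl⟩
  have : ContinuousSMul ℝ E := IsScalarTower.continuousSMul 𝕜
  have : LocallyConvexSpace ℝ E := hp.toLocallyConvexSpace
  have hconv : Convex ℝ s := fun φ hφ ψ hψ a b ha hb hab => hs φ hφ ψ hψ a b ha hb hab
  obtain ⟨f, u, hf, hu⟩ := RCLike.geometric_hahn_banach_closed_point (𝕜 := 𝕜)
    hconv.closure isClosed_closure hx
  exact ⟨f, u, fun φ hφ => hf φ (subset_closure hφ), hu⟩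

/-- Points outside the weak-* closure of a convex set are separated from it by an evaluation. -/
lemma WeakDual.exists_re_lt_of_notMem_closure {𝕜 E : Type*} [RCLike 𝕜] [NormedAddCommGroup E]
    [NormedSpace 𝕜 E] {s : Set (WeakDual 𝕜 E)} (hs : ∀ φ ∈ s, ∀ ψ ∈ s, ∀ a b : ℝ, 0 ≤ a → 0 ≤ b →
      a + b = 1 → (a : 𝕜) • φ + (b : 𝕜) • ψ ∈ s) {x : WeakDual 𝕜 E} (hx : x ∉ closure s) :
    ∃ (a : E) (u : ℝ), (∀ φ ∈ s, RCLike.re (φ a) < u) ∧ u < RCLike.re (x a) := by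
  obtain ⟨f, u, hf, hu⟩ :=
    (WeakDual.withSeminorms (𝕜 := 𝕜) (E := E)).exists_re_lt_of_notMem_closure hs hx
  -- Weak-* continuous functionals are exactly the evaluations at points of `E`.
  obtain ⟨a, ha⟩ := LinearMap.dualEmbedding_surjective (topDualPairing 𝕜 E) f
  have ha' : ∀ φ : WeakDual 𝕜 E, f φ = φ a := fun φ => by rw [← ha]; rfl
  exact ⟨a, u, fun φ hφ => by rw [← ha']; exact hf φ hφ, by rwa [← ha']⟩

/-! ### Compatible states, their density, and the trace -/

namespace CornerSystem

variable {A : Type*} [CStarAlgebra A] (S : CornerSystem A)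

lemma rho_unit_apply (n : ℕ) (c : S.C n) (x : EuclideanSpace ℂ (Fin (S.k n + 1))) :
    S.ρ n c (S.ρ n (S.unit n) x) = S.ρ n c x := by
  rw [← mul_apply_eq_comp, ← map_mul]
  congr 2
  exact Subtype.ext (S.right_unit n c c.2)

lemma rho_unit_idem (n : ℕ) (x : EuclideanSpace ℂ (Fin (S.k n + 1))) :
    S.ρ n (S.unit n) (S.ρ n (S.unit n) x) = S.ρ n (S.unit n) x := S.rho_unit_apply n _ x

variable [PartialOrder A]

/-- The states of `A` which restrict to states of `C_n` factoring through `ρ_n`. -/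
def compatible (n : ℕ) : Set (WeakDual ℂ A) :=
  {φ | φ ∈ stateSpace A ∧ φ (S.p n) = 1 ∧ ∀ c : S.C n, S.ρ n c = 0 → φ c = 0}

lemma convex_compatible (n : ℕ) : Convex ℝ (S.compatible n) := by
  intro φ hφ ψ hψ a b ha hb hab
  refine ⟨convex_stateSpace hφ.1 hψ.1 ha hb hab, ?_, fun c hc => ?_⟩
  · change a • φ (S.p n) + b • ψ (S.p n) = 1
    rw [hφ.2.1, hψ.2.1, ← add_smul, hab, one_smul]
  · change a • φ c + b • ψ c = 0
    rw [hφ.2.2 c hc, hψ.2.2 c hc, smul_zero, smul_zero, add_zero]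

/-- The limits along `l` of sequences of compatible states. -/
def limitStates (l : Filter ℕ) : Set (WeakDual ℂ A) :=
  {ψ | ∃ φ : ℕ → WeakDual ℂ A, (∀ n, φ n ∈ S.compatible n) ∧ Tendsto φ l (𝓝 ψ)}

lemma convex_limitStates (l : Filter ℕ) : Convex ℝ (S.limitStates l) := by
  rintro ψ ⟨φ, hφ, hφψ⟩ ψ' ⟨φ', hφ', hφψ'⟩ a b ha hb hab
  exact ⟨fun n => a • φ n + b • φ' n,
    fun n => S.convex_compatible n (hφ n) (hφ' n) ha hb hab,
    (hφψ.const_smul a).add (hφψ'.const_smul b)⟩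

lemma limitStates_subset (l : Filter ℕ) [l.NeBot] : S.limitStates l ⊆ stateSpace A := by
  rintro ψ ⟨φ, hφ, h⟩
  exact isClosed_stateSpace.mem_of_tendsto h (.of_forall fun n => (hφ n).1)

variable [StarOrderedRing A]

variable {S} in
/-- A compatible state is almost determined by its restriction to `C_n`. -/
lemma norm_state_sub_le {n : ℕ} {φ : WeakDual ℂ A} (hφ : φ ∈ S.compatible n) (a : A) (c : S.C n) :
    ‖φ a - φ c‖ ≤ ‖(c : A) - a * S.p n‖ := by
  rw [← state_mul_proj hφ.1 (S.isProj n) hφ.2.1 a, ← map_sub, norm_sub_rev]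
  exact state_norm_apply_le hφ.1 _

variable {S} in
lemma Represents.tendsto_state_sub {a : A} {c : ∀ n, S.C n} (hc : S.Represents a c)
    {φ : ℕ → WeakDual ℂ A} (hφ : ∀ n, φ n ∈ S.compatible n) :
    Tendsto (fun n => φ n a - φ n (c n)) atTop (𝓝 0) :=
  squeeze_zero_norm (fun n => norm_state_sub_le (hφ n) a (c n)) hc.tendsto

variable [Nontrivial A]

/-- A normalized family of vectors in the range of `ρ_n(p_n)` gives a compatible state. -/
lemma exists_compatible {n : ℕ} {ι : Type*} [Fintype ι]
    (ξ : ι → EuclideanSpace ℂ (Fin (S.k n + 1))) (h1 : ∑ i, ‖ξ i‖ ^ 2 = 1)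
    (hξ : ∀ i, S.ρ n (S.unit n) (ξ i) = ξ i) :
    ∃ φ ∈ S.compatible n, ∀ c : S.C n, φ c = ∑ i, ⟪ξ i, S.ρ n c (ξ i)⟫_ℂ := by
  let f : S.C n →ₗ[ℂ] ℂ :=
    { toFun := fun c => ∑ i, ⟪ξ i, S.ρ n c (ξ i)⟫_ℂ
      map_add' := fun c d => by
        simp [map_add, Finset.sum_add_distrib]
      map_smul' := fun z c => by
        simp [map_smul, Finset.mul_sum] }
  have hf : ∀ c, ‖f c‖ ≤ ‖c‖ := by
    intro c
    calc ‖f c‖ ≤ ∑ i, ‖⟪ξ i, S.ρ n c (ξ i)⟫_ℂ‖ := norm_sum_le _ _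
      _ ≤ ∑ i, ‖c‖ * ‖ξ i‖ ^ 2 := by
        refine Finset.sum_le_sum fun i _ => (norm_inner_le_norm _ _).trans ?_
        have h2 := (S.ρ n c).le_of_opNorm_le (S.norm_rho_le n c) (ξ i)
        nlinarith [norm_nonneg (ξ i)]
      _ = ‖c‖ := by rw [← Finset.mul_sum, h1, mul_one]
  have hf1 : f ⟨S.p n, S.mem n⟩ = 1 := by
    change ∑ i, ⟪ξ i, S.ρ n (S.unit n) (ξ i)⟫_ℂ = 1
    simp_rw [hξ, inner_self_eq_norm_sq_to_K]
    simpa using congrArg (Complex.ofReal) h1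
  obtain ⟨φ, hφ, hφf⟩ := exists_state_extension (S.C n) (S.isProj n) (S.mem n) f hf hf1
  refine ⟨φ, ⟨hφ, ?_, fun c hc => ?_⟩, hφf⟩
  · exact (hφf ⟨S.p n, S.mem n⟩).trans hf1
  · rw [hφf]
    change ∑ i, ⟪ξ i, S.ρ n c (ξ i)⟫_ℂ = 0
    simp [hc]

/-- Compatible states almost norm the elements `c^* c`. -/
lemma exists_compatible_norm {n : ℕ} (c : S.C n) {ε : ℝ} (hε : 0 < ε) :
    ∃ φ ∈ S.compatible n, ∃ t : ℝ, φ ((star c * c : S.C n) : A) = ((t ^ 2 : ℝ) : ℂ) ∧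
      ‖S.ρ n c‖ - ε ≤ t ∧ 0 ≤ t := by
  -- As `ρ_n` need not be unital, the vector is first moved into the range of `ρ_n(p_n)` and
  -- normalized. The first operation leaves `ρ_n(c) x` unchanged, and the second can only enlarge
  -- it.
  have key : ∀ x, S.ρ n (S.unit n) x ≠ 0 → ‖x‖ ≤ 1 → ∃ φ ∈ S.compatible n, ∃ t : ℝ,
      φ ((star c * c : S.C n) : A) = ((t ^ 2 : ℝ) : ℂ) ∧ ‖S.ρ n c x‖ ≤ t ∧ 0 ≤ t := by
    intro x hx hx1
    set η := S.ρ n (S.unit n) x with hη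
    have hη0 : 0 < ‖η‖ := norm_pos_iff.2 hx
    have hη1 : ‖η‖ ≤ 1 := by
      have := (S.ρ n (S.unit n)).le_of_opNorm_le (S.norm_rho_unit n).le x
      linarith
    set ξ := ((‖η‖⁻¹ : ℝ) : ℂ) • η with hξ
    have hξn : ‖ξ‖ = 1 := by
      rw [hξ, norm_smul, Complex.norm_real, norm_inv, norm_norm, inv_mul_cancel₀ hη0.ne']
    obtain ⟨φ, hφ, h⟩ := S.exists_compatible (n := n) (fun _ : Unit => ξ) (by simp [hξn])
      (fun _ => by rw [hξ, map_smul, hη, S.rho_unit_idem])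
    refine ⟨φ, hφ, ‖S.ρ n c ξ‖, ?_, ?_, norm_nonneg _⟩
    · rw [h]
      simp only [Finset.univ_unique, Finset.sum_singleton, map_mul, map_star,
        mul_apply_eq_comp, ContinuousLinearMap.star_eq_adjoint,
        ContinuousLinearMap.adjoint_inner_right, inner_self_eq_norm_sq_to_K]
      push_cast
      rfl
    · rw [hξ, map_smul, norm_smul, Complex.norm_real, norm_inv, norm_norm, hη, S.rho_unit_apply]
      exact le_mul_of_one_le_left (norm_nonneg _) ((one_le_inv₀ hη0).2 hη1)
  rcases lt_or_ge (‖S.ρ n c‖ - ε) 0 with h | h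
  · obtain ⟨x, hx, hx'⟩ := (S.ρ n (S.unit n)).exists_lt_apply_of_lt_opNorm
      (r := 0) (by rw [S.norm_rho_unit]; exact one_pos)
    obtain ⟨φ, hφ, t, ht, ht1, ht0⟩ := key x (norm_pos_iff.1 hx') hx.le
    exact ⟨φ, hφ, t, ht, h.le.trans ht0, ht0⟩
  · obtain ⟨x, hx, hx'⟩ := (S.ρ n c).exists_lt_apply_of_lt_opNorm (sub_lt_self _ hε)
    have hne : S.ρ n (S.unit n) x ≠ 0 := by
      intro h0
      rw [← S.rho_unit_apply, h0, map_zero, norm_zero] at hx'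
      exact absurd hx' (not_lt.2 h)
    obtain ⟨φ, hφ, t, ht, ht1, ht0⟩ := key x hne hx.le
    exact ⟨φ, hφ, t, ht, hx'.le.trans ht1, ht0⟩

/-- At stage `n` pick a compatible state which norms the lift of `v` up to `1/(n+1)`. Asymptotic
isometry makes the ultralimit at least `‖v‖ ^ 2` on `v^* v`; no state exceeds that value. -/
lemma exists_limitState_norm (hA : IsSimpleCStar A) {l : Ultrafilter ℕ}
    (hl : (l : Filter ℕ) ≤ atTop) (v : A) :
    ∃ ψ ∈ S.limitStates l, ψ (star v * v) = ((‖v‖ ^ 2 : ℝ) : ℂ) := by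
  choose φ hφ t ht ht1 ht0 using fun n : ℕ =>
    S.exists_compatible_norm (S.lift v n) (show (0 : ℝ) < 1 / ((n : ℝ) + 1) by positivity)
  obtain ⟨ψ, hψ, hlim⟩ := exists_tendsto_state (fun n => (hφ n).1) l
  refine ⟨ψ, ⟨φ, hφ, hlim⟩, ?_⟩
  have hv := S.represents_lift v
  have h1 : Tendsto (fun n => φ n (star v * v)) l (𝓝 (ψ (star v * v))) :=
    ((WeakDual.eval_continuous (star v * v)).tendsto ψ).comp hlim
  have h2 := ((hv.star.mul hv).tendsto_state_sub hφ).mono_left hl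
  have h3 : Tendsto (fun n => (((t n) ^ 2 : ℝ) : ℂ)) l (𝓝 (ψ (star v * v))) := by
    have := h1.sub h2
    rw [sub_zero] at this
    refine this.congr fun n => ?_
    rw [sub_sub_cancel, ← ht]
    rfl
  have h4 : Tendsto (fun n => (t n) ^ 2) l (𝓝 (ψ (star v * v)).re) := by
    refine ((Complex.continuous_re.tendsto _).comp h3).congr fun n => ?_
    exact Complex.ofReal_re _
  have h5 : Tendsto (fun n => (max (‖S.ρ n (S.lift v n)‖ - 1 / ((n : ℝ) + 1)) 0) ^ 2) l
      (𝓝 (‖v‖ ^ 2)) := by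
    have h6 := ((hv.tendsto_norm_rho hA hl).sub
      ((tendsto_one_div_add_atTop_nhds_zero_nat (𝕜 := ℝ)).mono_left hl)).max
      (tendsto_const_nhds (x := (0 : ℝ)))
    rw [sub_zero, max_eq_left (norm_nonneg v)] at h6
    exact h6.pow 2
  have h7 : ‖v‖ ^ 2 ≤ (ψ (star v * v)).re := le_of_tendsto_of_tendsto' h5 h4 fun n =>
    pow_le_pow_left₀ (le_max_right _ _) (max_le (ht1 n) (ht0 n)) 2
  have h8 := state_star_mul_self_le hψ v
  have h9 := state_norm_sq hψ v
  rw [← h9, Complex.ofReal_re] at h7 h8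
  rw [← h9, le_antisymm h8 h7]

/-- Limits of compatible states are weak-* dense in the state space. -/
lemma stateSpace_subset_closure_limitStates (hA : IsSimpleCStar A) {l : Ultrafilter ℕ}
    (hl : (l : Filter ℕ) ≤ atTop) : stateSpace A ⊆ closure (S.limitStates l) := by
  intro ω hω
  by_contra hne
  obtain ⟨a, u, hf, hu⟩ := WeakDual.exists_re_lt_of_notMem_closure (𝕜 := ℂ)
    (fun φ hφ ψ hψ r t hr ht hrt => S.convex_limitStates l hφ hψ hr ht hrt) hne
  -- Shifting `a + a^*` by its norm gives a positive `v^* v`, on which states are ordered as by `Re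
  -- φ(a)`. Some limit state attains `‖v‖ ^ 2` there, so no state `ω` can be separated beyond all
  -- limit states.
  set h : A := a + star a with hh
  have hsa : IsSelfAdjoint h := by simp [hh, IsSelfAdjoint, add_comm]
  have hpos : (0 : A) ≤ h + algebraMap ℝ A ‖h‖ := by
    rw [← sub_neg_eq_add]
    exact sub_nonneg.2 hsa.neg_algebraMap_norm_le_self
  obtain ⟨v, hv⟩ := CStarAlgebra.nonneg_iff_eq_star_mul_self.1 hpos
  have hval : ∀ φ ∈ stateSpace A, (φ (star v * v)).re = 2 * (φ a).re + ‖h‖ := by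
    intro φ hφ
    rw [← hv, map_add, Algebra.algebraMap_eq_smul_one, ← Complex.coe_smul, map_smul, hφ.1, hh,
      map_add, state_map_star hφ]
    simp
    ring
  obtain ⟨ψ, hψ, hψv⟩ := S.exists_limitState_norm hA hl v
  have h1 := hf ψ hψ
  have h2 := hval ψ (S.limitStates_subset _ hψ)
  have h3 := hval ω hω
  have h4 := state_star_mul_self_le hω v
  rw [hψv, Complex.ofReal_re] at h2
  simp only [RCLike.re_to_complex] at h1 hu
  linarith

/-- The compatible states of arbitrarily large index are dense in the state space. -/
lemma stateSpace_subset_closure_compatible (hA : IsSimpleCStar A) (N : ℕ) :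
    stateSpace A ⊆ closure (⋃ n ≥ N, S.compatible n) := by
  have hl : ((hyperfilter ℕ : Ultrafilter ℕ) : Filter ℕ) ≤ atTop := by
    rw [← Nat.cofinite_eq_atTop]; exact hyperfilter_le_cofinite
  refine (S.stateSpace_subset_closure_limitStates hA hl).trans
    (closure_minimal ?_ isClosed_closure)
  rintro ψ ⟨φ, hφ, h⟩
  refine mem_closure_of_tendsto h ?_
  filter_upwards [hl (eventually_ge_atTop N)] with n hn
  exact Set.mem_biUnion hn (hφ n)

/-- The ultralimit of the normalized traces of the `ρ_n` is a tracial state. -/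
lemma exists_tracialState (S : CornerSystem A) : ∃ τ : A →ₗ[ℂ] ℂ, IsTracialState τ := by
  have hl : ((hyperfilter ℕ : Ultrafilter ℕ) : Filter ℕ) ≤ atTop := by
    rw [← Nat.cofinite_eq_atTop]; exact hyperfilter_le_cofinite
  have hex : ∀ n, ∃ φ ∈ S.compatible n, ∀ c d : S.C n,
      φ ((c * d : S.C n) : A) = φ ((d * c : S.C n) : A) := by
    intro n
    let b := EuclideanSpace.basisFun (Fin (S.k n + 1)) ℂ
    set q := S.ρ n (S.unit n) with hq
    -- This is the trace of the projection `ρ_n(p_n)`, the normalizing constant.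
    set s := ∑ i, ‖q (b i)‖ ^ 2 with hs
    have hs0 : 0 < s := by
      refine (Finset.sum_nonneg fun i _ => sq_nonneg _).lt_of_ne fun h0 => S.ρ_ne n ?_
      have h1 := (Finset.sum_eq_zero_iff_of_nonneg (fun i _ => sq_nonneg ‖q (b i)‖)).1 h0.symm
      have h2 : (q : EuclideanSpace ℂ (Fin (S.k n + 1)) →ₗ[ℂ]
          EuclideanSpace ℂ (Fin (S.k n + 1))) = 0 :=
        b.toBasis.ext fun i => by
          have h3 : ‖q (b i)‖ ^ 2 = 0 := h1 i (Finset.mem_univ i)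
          rw [OrthonormalBasis.coe_toBasis]
          exact norm_eq_zero.1 (pow_eq_zero_iff two_ne_zero |>.1 h3)
      exact ContinuousLinearMap.coe_injective h2
    have hsq : ((√s : ℝ) : ℂ) * ((√s : ℝ) : ℂ) = (s : ℂ) := by
      rw [← Complex.ofReal_mul, Real.mul_self_sqrt hs0.le]
    obtain ⟨φ, hφ, h⟩ := S.exists_compatible (n := n)
      (fun i => (((√s)⁻¹ : ℝ) : ℂ) • q (b i))
      (by
        simp_rw [norm_smul, mul_pow, ← Finset.mul_sum]
        rw [← hs, Complex.norm_real, Real.norm_of_nonneg (by positivity), inv_pow,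
          Real.sq_sqrt hs0.le, inv_mul_cancel₀ hs0.ne'])
      (fun i => by rw [map_smul, S.rho_unit_idem])
    refine ⟨φ, hφ, ?_⟩
    have htr : ∀ c : S.C n, φ c = (s⁻¹ : ℝ) *
        LinearMap.trace ℂ _ (S.ρ n c : EuclideanSpace ℂ (Fin (S.k n + 1)) →ₗ[ℂ] _) := by
      intro c
      rw [h, LinearMap.trace_eq_sum_inner _ b, Finset.mul_sum]
      refine Finset.sum_congr rfl fun i _ => ?_
      have e1 : ⟪q (b i), S.ρ n c (q (b i))⟫_ℂ = ⟪b i, S.ρ n c (b i)⟫_ℂ := by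
        rw [hq, S.rho_unit_apply]
        have e2 : S.ρ n (S.unit n) = ContinuousLinearMap.adjoint (S.ρ n (S.unit n)) := by
          rw [← ContinuousLinearMap.star_eq_adjoint, ← map_star]
          congr 1
          exact Subtype.ext (S.isProj n).isSelfAdjoint.star_eq.symm
        rw [e2, ContinuousLinearMap.adjoint_inner_left, ← mul_apply_eq_comp,
          ← map_mul]
        congr 3
        exact Subtype.ext (S.left_unit n c c.2)
      rw [map_smul, inner_smul_left, inner_smul_right, e1, Complex.conj_ofReal, ← mul_assoc,
        ← Complex.ofReal_mul, ← mul_inv, Real.mul_self_sqrt hs0.le]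
      rfl
    intro c d
    rw [htr, htr, map_mul, map_mul]
    congr 1
    exact LinearMap.trace_mul_comm ℂ
      (S.ρ n c : EuclideanSpace ℂ (Fin (S.k n + 1)) →ₗ[ℂ] EuclideanSpace ℂ (Fin (S.k n + 1)))
      (S.ρ n d : EuclideanSpace ℂ (Fin (S.k n + 1)) →ₗ[ℂ] EuclideanSpace ℂ (Fin (S.k n + 1)))
  choose φ hφ htr using hex
  obtain ⟨ψ, hψ, hlim⟩ := exists_tendsto_state (fun n => (hφ n).1) (hyperfilter ℕ)
  refine ⟨(WeakDual.toStrongDual ψ : A →ₗ[ℂ] ℂ), hψ.2, hψ.1, fun a b => ?_⟩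
  change ψ (a * b) = ψ (b * a)
  have key : ∀ x y : A, Tendsto (fun n => φ n ((S.lift x n * S.lift y n : S.C n) : A))
      (hyperfilter ℕ) (𝓝 (ψ (x * y))) := by
    intro x y
    have h1 : Tendsto (fun n => φ n (x * y)) (hyperfilter ℕ) (𝓝 (ψ (x * y))) :=
      ((WeakDual.eval_continuous (x * y)).tendsto ψ).comp hlim
    have h2 := h1.sub
      ((((S.represents_lift x).mul (S.represents_lift y)).tendsto_state_sub hφ).mono_left hl)
    rw [sub_zero] at h2
    exact h2.congr fun n => sub_sub_cancel _ _
  exact tendsto_nhds_unique (key a b) ((key b a).congr fun n => htr n _ _)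

end CornerSystem

/-! ### Almost reducing subspaces and the Baire argument -/

section AlmostReducing

variable {A : Type*} [CStarAlgebra A]

/-- In the GNS representation of `φ` there is a finite dimensional subspace which is almost
invariant under `F` and almost contains the vectors represented by `F`. -/
def AlmostReducing (φ : WeakDual ℂ A) (F : Finset A) (ε : ℝ) : Prop :=
  ∃ E : Submodule ℂ A, FiniteDimensional ℂ E ∧
    (∀ a ∈ F, ∀ e ∈ E, ∃ e' ∈ E, (φ (star (a * e - e') * (a * e - e'))).re ≤
      ε ^ 2 * (φ (star e * e)).re) ∧
    ∀ a ∈ F, ∃ e' ∈ E, (φ (star (a - e') * (a - e'))).re ≤ ε ^ 2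

variable [PartialOrder A] [StarOrderedRing A]

lemma state_mul_left_le {φ : WeakDual ℂ A} (hφ : φ ∈ stateSpace A) (x e : A) :
    ‖(positiveOfState hφ).toPreGNS (x * e)‖ ≤ ‖x‖ * ‖(positiveOfState hφ).toPreGNS e‖ :=
  ((positiveOfState hφ).leftMulMapPreGNS x).le_of_opNorm_le
    (LinearMap.mkContinuous_norm_le _ (norm_nonneg _) _) ((positiveOfState hφ).toPreGNS e)

/-- Evaluation is jointly continuous because states are uniformly contractive. This permits varying
the state and a vector of a finite dimensional subspace together. -/
lemma continuous_state_apply :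
    Continuous fun z : stateSpace A × A => (z.1 : WeakDual ℂ A) z.2 := by
  rw [continuous_iff_continuousAt]
  rintro ⟨φ, x⟩
  have h1 : Tendsto (fun z : stateSpace A × A => (z.1 : WeakDual ℂ A) x) (𝓝 (φ, x))
      (𝓝 ((φ : WeakDual ℂ A) x)) :=
    (((WeakDual.eval_continuous x).comp continuous_subtype_val).comp continuous_fst).tendsto _
  refine h1.congr_dist (squeeze_zero (fun _ => dist_nonneg) (fun z => ?_)
    (g := fun z => dist x z.2) ?_)
  · rw [dist_eq_norm, dist_eq_norm, ← map_sub]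
    exact state_norm_apply_le z.1.2 _
  · have : Continuous fun z : stateSpace A × A => dist x z.2 := by fun_prop
    simpa using this.tendsto (φ, x)

namespace CornerSystem

variable {S : CornerSystem A}

/-- States close to a compatible state inherit an almost reducing subspace. -/
lemma eventually_almostReducing {n : ℕ} (φ : stateSpace A) (hφ : (φ : WeakDual ℂ A) ∈ S.compatible n)
    {F : Finset A} {ε : ℝ} (c : A → S.C n)
    (hc : ∀ a ∈ F, ‖(c a : A) - a * S.p n‖ < ε) :
    ∀ᶠ ψ : stateSpace A in 𝓝 φ, AlmostReducing (ψ : WeakDual ℂ A) F ε := by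
  set f := positiveOfState φ.2 with hf
  have hsq : ∀ x, ((φ : WeakDual ℂ A) (star x * x)).re = ‖f.toPreGNS x‖ ^ 2 := fun x => by
    rw [← state_norm_sq φ.2, Complex.ofReal_re]
  -- the null space of `φ` on `C_n` and a complement
  let v : S.C n →ₗ[ℂ] f.PreGNS := (f.toPreGNS : A →ₗ[ℂ] f.PreGNS) ∘ₗ (S.C n).toSubmodule.subtype
  have hv : ∀ x : S.C n, v x = f.toPreGNS (x : A) := fun _ => rfl
  let N : Submodule ℂ (S.C n) :=
    { carrier := {x | ‖v x‖ = 0}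
      zero_mem' := by simp
      add_mem' := fun {x y} hx hy => le_antisymm
        (by
          rw [map_add]
          exact (norm_add_le _ _).trans (by rw [hx, hy, add_zero])) (norm_nonneg _)
      smul_mem' := fun z x hx => by
        change ‖v (z • x)‖ = 0
        rw [map_smul, norm_smul, show ‖v x‖ = 0 from hx, mul_zero] }
  have hN : ∀ x, x ∈ N ↔ ‖v x‖ = 0 := fun _ => Iff.rfl
  have hker : ∀ x, S.ρ n x = 0 → x ∈ N := fun x hx => by
    have h1 := hφ.2.2 (star x * x) (by rw [map_mul, hx, mul_zero])
    have h2 := hsq x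
    rw [show star (x : A) * (x : A) = ((star x * x : S.C n) : A) from rfl, h1,
      Complex.zero_re] at h2
    exact pow_eq_zero_iff two_ne_zero |>.1 h2.symm
  obtain ⟨E, hE⟩ := Submodule.exists_isCompl N
  -- Compatibility puts `ker ρ_n` inside the null space `N`, so `ρ_n` is injective on the complement
  -- `E`.
  have hfin : FiniteDimensional ℂ E := by
    refine Module.Finite.of_injective
      (((S.ρ n : S.C n →ₗ[ℂ] _) : S.C n →ₗ[ℂ] (EuclideanSpace ℂ (Fin (S.k n + 1)) →L[ℂ]
        EuclideanSpace ℂ (Fin (S.k n + 1)))) ∘ₗ E.subtype) ?_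
    rw [injective_iff_map_eq_zero]
    intro e he
    have h1 : (e : S.C n) ∈ N := hker _ he
    exact Subtype.ext (Submodule.disjoint_def.1 hE.disjoint _ h1 e.2)
  let proj : S.C n →ₗ[ℂ] E := E.projectionOnto N hE.symm
  have hproj : ∀ x : S.C n, ‖f.toPreGNS ((x : A) - ((proj x : S.C n) : A))‖ = 0 := by
    intro x
    have : x - (proj x : S.C n) ∈ N :=
      (Submodule.projectionOnto_apply_eq_zero_iff hE.symm).1 (by
        rw [map_sub, Submodule.projectionOnto_apply_left, sub_self])
    exact (hN _).1 this
  -- Left multiplication by `c a ≈ a p_n`, pushed back into `E`; the push moves vectors only by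
  -- `φ`-null elements.
  let T : A → E →ₗ[ℂ] E := fun a =>
    proj ∘ₗ (LinearMap.mulLeft ℂ (c a)) ∘ₗ E.subtype
  have hT : ∀ a (e : E), T a e = proj (c a * (e : S.C n)) := fun _ _ => rfl
  have hbound : ∀ a, ∀ e : E, ‖f.toPreGNS (a * (e : S.C n) - ((T a e : S.C n) : A))‖ ≤
      ‖(c a : A) - a * S.p n‖ * ‖f.toPreGNS ((e : S.C n) : A)‖ := by
    intro a e
    have e1 : a * ((e : S.C n) : A) - ((T a e : S.C n) : A) =
        -(((c a : A) - a * S.p n) * ((e : S.C n) : A)) +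
        (((c a * (e : S.C n) : S.C n) : A) - ((T a e : S.C n) : A)) := by
      have := S.left_unit n _ (e : S.C n).2
      rw [sub_mul, mul_assoc a, this, MulMemClass.coe_mul]
      abel
    rw [e1, map_add, map_neg]
    refine (norm_add_le _ _).trans ?_
    rw [norm_neg, hT, hproj, add_zero]
    exact state_mul_left_le φ.2 _ _
  let g : A → stateSpace A × E → ℝ := fun a z =>
    ε ^ 2 * ((z.1 : WeakDual ℂ A) (star ((z.2 : S.C n) : A) * ((z.2 : S.C n) : A))).re -
    ((z.1 : WeakDual ℂ A) (star (a * ((z.2 : S.C n) : A) - ((T a z.2 : S.C n) : A)) *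
      (a * ((z.2 : S.C n) : A) - ((T a z.2 : S.C n) : A)))).re
  have hg : ∀ a, Continuous (g a) := by
    intro a
    have hTc : Continuous (T a) := LinearMap.continuous_of_finiteDimensional _
    have hc1 : Continuous fun z : stateSpace A × E => ((z.2 : S.C n) : A) := by fun_prop
    have hc2 : Continuous fun z : stateSpace A × E => ((T a z.2 : S.C n) : A) :=
      continuous_subtype_val.comp (continuous_subtype_val.comp (hTc.comp continuous_snd))
    have key : ∀ h : stateSpace A × E → A, Continuous h → Continuous fun z : stateSpace A × E =>
        ((z.1 : WeakDual ℂ A) (star (h z) * h z)).re := fun h hh =>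
      Complex.continuous_re.comp (continuous_state_apply.comp
        (continuous_fst.prodMk (hh.star.mul hh)))
    exact (continuous_const.mul (key _ hc1)).sub
      (key _ ((continuous_const.mul hc1).sub hc2))
  -- The invariance inequality is strict at `φ` on the unit sphere of `E`. That sphere is compact,
  -- so one neighbourhood of `φ` works for all its points.
  have h1 : ∀ a ∈ F, ∀ᶠ ψ : stateSpace A in 𝓝 φ, ∀ e ∈ Metric.sphere (0 : E) 1, 0 < g a (ψ, e) := by
    intro a ha
    have := FiniteDimensional.proper ℂ E
    refine (isCompact_sphere (0 : E) 1).eventually_forall_of_forall_eventually fun e he => ?_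
    refine (hg a).continuousAt.eventually (lt_mem_nhds (?_ : (0 : ℝ) < g a (φ, e)))
    have he0 : 0 < ‖f.toPreGNS ((e : S.C n) : A)‖ := by
      refine (norm_nonneg _).lt_of_ne fun h0 => ?_
      have h2 : (e : S.C n) ∈ N := (hN _).2 h0.symm
      have h3 : e = 0 := Subtype.ext (Submodule.disjoint_def.1 hE.disjoint _ h2 e.2)
      rw [h3] at he
      simp at he
    have h4 := hbound a e
    simp only [g, hsq]
    have h5 : ‖f.toPreGNS (a * (e : S.C n) - ((T a e : S.C n) : A))‖ <
        ε * ‖f.toPreGNS ((e : S.C n) : A)‖ :=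
      h4.trans_lt (mul_lt_mul_of_pos_right (hc a ha) he0)
    rw [sub_pos, ← mul_pow]
    exact pow_lt_pow_left₀ h5 (norm_nonneg _) two_ne_zero
  have h2 : ∀ a ∈ F, ∀ᶠ ψ : stateSpace A in 𝓝 φ, ((ψ : WeakDual ℂ A)
      (star (a - ((proj (c a) : S.C n) : A)) * (a - ((proj (c a) : S.C n) : A)))).re < ε ^ 2 := by
    intro a ha
    have hcont : Continuous fun ψ : stateSpace A => ((ψ : WeakDual ℂ A)
        (star (a - ((proj (c a) : S.C n) : A)) * (a - ((proj (c a) : S.C n) : A)))).re :=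
      Complex.continuous_re.comp ((WeakDual.eval_continuous _).comp continuous_subtype_val)
    refine hcont.continuousAt.eventually (gt_mem_nhds ?_)
    beta_reduce
    rw [hsq]
    refine pow_lt_pow_left₀ ?_ (norm_nonneg _) two_ne_zero
    have e1 : a - ((proj (c a) : S.C n) : A) = a * (1 - S.p n) +
        (-((c a : A) - a * S.p n) + ((c a : A) - ((proj (c a) : S.C n) : A))) := by
      noncomm_ring
    have e2 : ‖f.toPreGNS (a * (1 - S.p n))‖ ≤ 0 := by
      refine (state_mul_left_le φ.2 _ _).trans (le_of_eq ?_)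
      have hq := (S.isProj n).one_sub
      rw [state_norm_eq, hq.isSelfAdjoint.star_eq, hq.isIdempotentElem.eq, map_sub, φ.2.1,
        hφ.2.1, sub_self, Complex.zero_re, Real.sqrt_zero, mul_zero]
    rw [e1, map_add, map_add, map_neg]
    refine ((norm_add_le _ _).trans (add_le_add e2 (norm_add_le _ _))).trans_lt ?_
    rw [norm_neg, hproj, add_zero, zero_add]
    exact (state_norm_le_norm φ.2 _).trans_lt (hc a ha)
  have h1' := (Finset.eventually_all F).2 h1
  have h2' := (Finset.eventually_all F).2 h2
  filter_upwards [h1', h2'] with ψ hψ1 hψ2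
  -- The subspace lies in `A`, not in a particular GNS space, so the same one serves every nearby
  -- `ψ`. Homogeneity of degree two (`hhom`) extends the estimate from the sphere to all of `E`.
  refine ⟨E.map (S.C n).toSubmodule.subtype, inferInstance, ?_, fun a ha =>
    ⟨_, ⟨(proj (c a) : S.C n), (proj (c a)).2, rfl⟩, (hψ2 a ha).le⟩⟩
  rintro a ha _ ⟨e, he, rfl⟩
  refine ⟨_, ⟨(T a ⟨e, he⟩ : S.C n), (T a ⟨e, he⟩).2, rfl⟩, ?_⟩
  have hhom : ∀ (r : ℝ) (e : E), g a (ψ, (r : ℂ) • e) = r ^ 2 * g a (ψ, e) := by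
    intro r e
    have key : ∀ x : A, ((ψ : WeakDual ℂ A) (star ((r : ℂ) • x) * ((r : ℂ) • x))).re =
        r ^ 2 * ((ψ : WeakDual ℂ A) (star x * x)).re := by
      intro x
      rw [star_smul, smul_mul_smul_comm, map_smul, Complex.star_def, Complex.conj_ofReal,
        ← Complex.ofReal_mul, smul_eq_mul, Complex.re_ofReal_mul, sq]
    have e1 : (((((r : ℂ) • e : E) : S.C n)) : A) = (r : ℂ) • ((e : S.C n) : A) := rfl
    have e2 : (((T a ((r : ℂ) • e) : E) : S.C n) : A) = (r : ℂ) • ((T a e : S.C n) : A) := by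
      rw [map_smul]; rfl
    have e3 : a * ((r : ℂ) • ((e : S.C n) : A)) = (r : ℂ) • (a * ((e : S.C n) : A)) :=
      mul_smul_comm _ _ _
    simp only [g]
    rw [e1, e2, e3, ← smul_sub, key, key]
    ring
  have hfinal : 0 ≤ g a (ψ, ⟨e, he⟩) := by
    rcases eq_or_ne (⟨e, he⟩ : E) 0 with h | h
    · rw [h]; simp [g]
    · have h3 := hψ1 a ha (((‖(⟨e, he⟩ : E)‖⁻¹ : ℝ) : ℂ) • ⟨e, he⟩) (by
        rw [mem_sphere_zero_iff_norm, norm_smul, Complex.norm_real, norm_inv, norm_norm,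
          inv_mul_cancel₀ (norm_ne_zero_iff.2 h)])
      rw [hhom] at h3
      exact (pos_of_mul_pos_right h3 (sq_nonneg _)).le
  exact sub_nonneg.1 hfinal

/-- Some state is almost reducing for every member of a sequence of finite sets. -/
lemma exists_state_almostReducing [Nontrivial A] (S : CornerSystem A) (hA : IsSimpleCStar A)
    (F : ℕ → Finset A) {ε : ℕ → ℝ} (hε : ∀ k, 0 < ε k) :
    ∃ ω ∈ stateSpace A, ∀ k, AlmostReducing ω (F k) (ε k) := by
  have : CompactSpace (stateSpace A) := isCompact_iff_compactSpace.1 isCompact_stateSpace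
  let U : ℕ → Set (stateSpace A) := fun k =>
    interior {ψ | AlmostReducing (ψ : WeakDual ℂ A) (F k) (ε k)}
  -- Each compatible state of large index is an interior point, and these states are dense.
  have hU : ∀ k, Dense (U k) := by
    intro k
    have h1 : ∀ᶠ n in atTop, ∀ a ∈ F k, ‖(S.lift a n : A) - a * S.p n‖ < ε k :=
      (Finset.eventually_all (F k)).2 fun a _ =>
        (S.represents_lift a).tendsto.eventually (gt_mem_nhds (hε k))
    obtain ⟨N, hN⟩ := eventually_atTop.1 h1
    intro φ
    rw [closure_subtype]
    refine closure_mono ?_ (S.stateSpace_subset_closure_compatible hA N φ.2)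
    simp only [Set.iUnion_subset_iff]
    intro n hn ψ hψ
    exact ⟨⟨ψ, hψ.1⟩, mem_interior_iff_mem_nhds.2
      (eventually_almostReducing ⟨ψ, hψ.1⟩ hψ (fun a => S.lift a n) (hN n hn)), rfl⟩
  have hne : Nonempty (stateSpace A) := by
    obtain ⟨φ, hφ, -⟩ := S.exists_compatible_norm (n := 0) 0 one_pos
    exact ⟨⟨φ, hφ.1⟩⟩
  obtain ⟨ω, hω⟩ := (dense_iInter_of_isOpen_nat (fun k => isOpen_interior) hU).nonempty
  refine ⟨ω, ω.2, fun k => ?_⟩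
  have h : ω ∈ {ψ : stateSpace A | AlmostReducing (ψ : WeakDual ℂ A) (F k) (ε k)} :=
    interior_subset (Set.mem_iInter.1 hω k)
  exact h

end CornerSystem

end AlmostReducing

/-! ### Separable Hilbert spaces and the GNS representation -/

section Separable

lemma Orthonormal.countable {H : Type*} [NormedAddCommGroup H] [InnerProductSpace ℂ H]
    [TopologicalSpace.SeparableSpace H] {ι : Type*} {b : ι → H} (hb : Orthonormal ℂ b) :
    Countable ι := by
  rw [← Set.countable_univ_iff]
  refine Set.PairwiseDisjoint.countable_of_isOpen (s := fun i => Metric.ball (b i) (1 / 2))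
    (fun i _ j _ hij => Metric.ball_disjoint_ball ?_) (fun i _ => Metric.isOpen_ball)
    (fun i _ => ⟨b i, Metric.mem_ball_self (by norm_num)⟩)
  have h : ‖b i - b j‖ ^ 2 = 2 := by
    rw [@norm_sub_sq ℂ, hb.1, hb.1, hb.2 hij]; norm_num
  rw [dist_eq_norm]
  nlinarith [norm_nonneg (b i - b j)]

/-- A separable Hilbert space has a copy in `Type`. -/
lemma exists_linearIsometryEquiv_type (H : Type*) [NormedAddCommGroup H] [InnerProductSpace ℂ H]
    [CompleteSpace H] [TopologicalSpace.SeparableSpace H] :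
    ∃ (K : Type) (_ : NormedAddCommGroup K) (_ : InnerProductSpace ℂ K) (_ : CompleteSpace K),
      Nonempty (H ≃ₗᵢ[ℂ] K) := by
  obtain ⟨w, b, -⟩ := exists_hilbertBasis ℂ H
  have := b.orthonormal.countable
  obtain ⟨f, hf⟩ := exists_injective_nat w
  let e := (Equiv.ofInjective f hf).symm
  have ho : Orthonormal ℂ (b ∘ e) := b.orthonormal.comp e e.injective
  let b' := HilbertBasis.mk ho (by rw [e.surjective.range_comp, b.dense_span])
  exact ⟨_, inferInstance, inferInstance, inferInstance, ⟨b'.repr⟩⟩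

end Separable

section GNS

variable {A : Type*} [CStarAlgebra A] [PartialOrder A] [StarOrderedRing A]

/-- The GNS representation of a state of a separable algebra, on a Hilbert space in `Type`. -/
lemma exists_gns_type [TopologicalSpace.SeparableSpace A] {ω : WeakDual ℂ A}
    (hω : ω ∈ stateSpace A) :
    ∃ (H : Type) (_ : NormedAddCommGroup H) (_ : InnerProductSpace ℂ H) (_ : CompleteSpace H)
      (π : A →⋆ₙₐ[ℂ] (H →L[ℂ] H)) (v : A →ₗ[ℂ] H), (∀ a b, π a (v b) = v (a * b)) ∧
      (∀ a, ‖v a‖ ^ 2 = (ω (star a * a)).re) ∧ DenseRange v := by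
  set f := positiveOfState hω with hf
  let v₀ : A →ₗ[ℂ] f.GNS :=
    (UniformSpace.Completion.toComplₗᵢ (𝕜 := ℂ) (E := f.PreGNS)).toLinearMap ∘ₗ
      (f.toPreGNS : A →ₗ[ℂ] f.PreGNS)
  have hv₀ : ∀ a, v₀ a = ((f.toPreGNS a : f.PreGNS) : f.GNS) := fun _ => rfl
  have hdense : DenseRange v₀ :=
    UniformSpace.Completion.denseRange_coe.comp f.toPreGNS.surjective.denseRange
      (UniformSpace.Completion.continuous_coe _)
  have hcont : Continuous v₀ := by
    refine AddMonoidHomClass.continuous_of_bound v₀ 1 fun a => ?_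
    rw [hv₀, UniformSpace.Completion.norm_coe, one_mul]
    exact state_norm_le_norm hω a
  have : TopologicalSpace.SeparableSpace f.GNS := hdense.separableSpace hcont
  -- The GNS space lives in the universe of `A`, while `IsQuasidiagonal` asks for a Hilbert space in
  -- `Type`; separability allows the transfer.
  obtain ⟨K, i1, i2, i3, ⟨e⟩⟩ := exists_linearIsometryEquiv_type f.GNS
  refine ⟨K, i1, i2, i3, (NonUnitalStarAlgHomClass.toNonUnitalStarAlgHom e.conjStarAlgEquiv).comp f.gnsNonUnitalStarAlgHom,
    e.toLinearEquiv.toLinearMap ∘ₗ v₀, fun a b => ?_, fun a => ?_,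
    e.surjective.denseRange.comp hdense e.continuous⟩
  · change e.conjStarAlgEquiv (f.gnsNonUnitalStarAlgHom a) (e (v₀ b)) = e (v₀ (a * b))
    rw [LinearIsometryEquiv.conjStarAlgEquiv_apply_apply, e.symm_apply_apply, hv₀,
      PositiveLinearMap.gnsNonUnitalStarAlgHom_apply_coe]
    rfl
  · change ‖e (v₀ a)‖ ^ 2 = _
    rw [e.norm_map, hv₀, UniformSpace.Completion.norm_coe, ← state_norm_sq hω, Complex.ofReal_re]

end GNS

/-! ### Perturbation of finite rank projections -/

section Projections

variable {H : Type*} [NormedAddCommGroup H] [InnerProductSpace ℂ H]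

lemma norm_sub_starProjection_le (E : Submodule ℂ H) [E.HasOrthogonalProjection] (x : H) {y : H}
    (hy : y ∈ E) : ‖x - E.starProjection x‖ ≤ ‖x - y‖ := by
  rw [Submodule.starProjection_minimal]
  exact ciInf_le ⟨0, by rintro _ ⟨z, rfl⟩; exact norm_nonneg _⟩ (⟨y, hy⟩ : E)

/-- A finite dimensional subspace `V` almost contained in `E` is contained in a small perturbation
of `E`. -/
lemma exists_perturbed_submodule {V E : Submodule ℂ H} [FiniteDimensional ℂ V]
    [FiniteDimensional ℂ E] {δ : ℝ} (hδ0 : 0 ≤ δ) (hδ : δ ≤ 1 / 2)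
    (h : ∀ v ∈ V, ‖v - E.starProjection v‖ ≤ δ * ‖v‖) :
    ∃ E' : Submodule ℂ H, FiniteDimensional ℂ E' ∧ V ≤ E' ∧
      (∀ x ∈ E', ‖x - E.starProjection x‖ ≤ δ * ‖x‖) ∧
      ∀ e ∈ E, ∃ x ∈ E', ‖e - x‖ ≤ 2 * δ * ‖e‖ := by
  refine ⟨V ⊔ (E ⊓ Vᗮ), ?_, le_sup_left, ?_, ?_⟩
  · have : FiniteDimensional ℂ (E ⊓ Vᗮ : Submodule ℂ H) :=
      Submodule.finiteDimensional_of_le inf_le_left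
    infer_instance
  · intro x hx
    obtain ⟨v, hv, y, hy, rfl⟩ := Submodule.mem_sup.1 hx
    have h1 : E.starProjection y = y := Submodule.starProjection_eq_self_iff.2 hy.1
    have h2 : v + y - E.starProjection (v + y) = v - E.starProjection v := by
      rw [map_add, h1]; abel
    rw [h2]
    refine (h v hv).trans (mul_le_mul_of_nonneg_left ?_ hδ0)
    have h3 := norm_add_sq_eq_norm_sq_add_norm_sq_of_inner_eq_zero v y
      (Submodule.inner_right_of_mem_orthogonal (𝕜 := ℂ) hv hy.2)
    nlinarith [norm_nonneg v, norm_nonneg y, norm_nonneg (v + y)]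
  -- The operator `M = P_V P_E` on `V` is invertible, since `P_E v = 0` contradicts `δ ≤ 1/2`.
  -- Solving `M v = P_V e` and setting `w = P_E v` places `e - w` in `E ⊓ Vᗮ`, so `v + (e - w)` lies
  -- in the new space at distance `‖v - w‖` from `e`.
  · intro e he
    let M : V →ₗ[ℂ] V :=
      ((V.orthogonalProjectionOnto ∘L E.starProjection : H →L[ℂ] V) : H →ₗ[ℂ] V) ∘ₗ V.subtype
    have hM : ∀ v : V, M v = V.orthogonalProjectionOnto (E.starProjection (v : H)) := fun _ => rfl
    have hinj : Function.Injective M := by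
      rw [injective_iff_map_eq_zero]
      intro v hv
      rw [hM, Submodule.orthogonalProjectionOnto_eq_zero_iff] at hv
      have h1 : ⟪E.starProjection (v : H), E.starProjection (v : H)⟫_ℂ = 0 := by
        rw [Submodule.inner_starProjection_left_eq_right,
          Submodule.starProjection_eq_self_iff.2 (Submodule.starProjection_apply_mem _ _)]
        exact Submodule.inner_right_of_mem_orthogonal v.2 hv
      have h2 := h v v.2
      rw [inner_self_eq_zero.1 h1, sub_zero] at h2
      have h3 : ‖(v : H)‖ = 0 := by nlinarith [norm_nonneg (v : H)]
      exact Subtype.ext (norm_eq_zero.1 h3)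
    obtain ⟨v, hv⟩ := LinearMap.injective_iff_surjective.1 hinj (V.orthogonalProjectionOnto e)
    rw [hM] at hv
    set w := E.starProjection (v : H) with hw
    have hwE : w ∈ E := Submodule.starProjection_apply_mem _ _
    have hxV : e - w ∈ Vᗮ := by
      rw [← Submodule.orthogonalProjectionOnto_eq_zero_iff, map_sub, hv, sub_self]
    have hxE : e - w ∈ E := E.sub_mem he hwE
    refine ⟨v + (e - w), Submodule.add_mem_sup v.2 ⟨hxE, hxV⟩, ?_⟩
    have h1 : e - (v + (e - w)) = -((v : H) - w) := by abel
    rw [h1, norm_neg]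
    have h2 := h v v.2
    rw [← hw] at h2
    refine h2.trans ?_
    have h3 : ⟪w, e - w⟫_ℂ = 0 := by
      rw [hw, Submodule.inner_starProjection_left_eq_right,
        Submodule.starProjection_eq_self_iff.2 hxE]
      exact Submodule.inner_right_of_mem_orthogonal v.2 hxV
    have h4 := norm_add_sq_eq_norm_sq_add_norm_sq_of_inner_eq_zero w (e - w) h3
    rw [add_sub_cancel] at h4
    have h5 : ‖w‖ ≤ ‖e‖ := by
      nlinarith [norm_nonneg w, norm_nonneg e, mul_self_nonneg ‖e - w‖]
    have h6 : ‖(v : H)‖ ≤ ‖(v : H) - w‖ + ‖w‖ := by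
      simpa using norm_add_le ((v : H) - w) w
    have h7 : ‖(v : H)‖ ≤ 2 * ‖e‖ := by nlinarith [norm_nonneg (v : H)]
    nlinarith

/-- Strong convergence is uniform on the unit ball of a finite dimensional space: sum the errors
over an orthonormal basis. -/
lemma norm_sub_starProjection_eventually_le {W : ℕ → Submodule ℂ H}
    [∀ n, (W n).HasOrthogonalProjection]
    (hW : ∀ ξ, Tendsto (fun n => ‖ξ - (W n).starProjection ξ‖) atTop (𝓝 0))
    (V : Submodule ℂ H) [FiniteDimensional ℂ V] {δ : ℝ} (hδ : 0 < δ) :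
    ∀ᶠ n in atTop, ∀ v ∈ V, ‖v - (W n).starProjection v‖ ≤ δ * ‖v‖ := by
  let b := stdOrthonormalBasis ℂ V
  have h1 : Tendsto (fun n => ∑ i, ‖(b i : H) - (W n).starProjection (b i : H)‖) atTop (𝓝 0) := by
    simpa using tendsto_finsetSum Finset.univ fun i _ => hW (b i : H)
  filter_upwards [h1.eventually (gt_mem_nhds hδ)] with n hn v hv
  have h2 : v = ∑ i, ⟪b i, (⟨v, hv⟩ : V)⟫_ℂ • (b i : H) := by
    have := congrArg (Subtype.val : V → H) (b.sum_repr' ⟨v, hv⟩)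
    rw [Submodule.coe_sum] at this
    exact this.symm
  have h3 : v - (W n).starProjection v =
      ∑ i, ⟪b i, (⟨v, hv⟩ : V)⟫_ℂ • ((b i : H) - (W n).starProjection (b i : H)) := by
    conv_lhs => rw [h2]
    simp only [map_sum, map_smul, smul_sub, Finset.sum_sub_distrib]
  rw [h3]
  refine (norm_sum_le _ _).trans ?_
  have h4 : ∀ i, ‖⟪b i, (⟨v, hv⟩ : V)⟫_ℂ‖ ≤ ‖v‖ := fun i =>
    (norm_inner_le_norm _ _).trans (by rw [b.orthonormal.1, one_mul]; rfl)
  calc _ ≤ ∑ i, ‖v‖ * ‖(b i : H) - (W n).starProjection (b i : H)‖ := by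
        refine Finset.sum_le_sum fun i _ => ?_
        rw [norm_smul]
        exact mul_le_mul_of_nonneg_right (h4 i) (norm_nonneg _)
    _ ≤ δ * ‖v‖ := by
        rw [← Finset.mul_sum, mul_comm]
        exact mul_le_mul_of_nonneg_right hn.le (norm_nonneg _)

lemma norm_starProjection_mul_one_sub_le {V E : Submodule ℂ H} [V.HasOrthogonalProjection]
    [E.HasOrthogonalProjection] {T : H →L[ℂ] H} {δ : ℝ} (hδ : 0 ≤ δ)
    (h : ∀ v ∈ V, ‖T v - E.starProjection (T v)‖ ≤ δ * ‖v‖) :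
    ‖T * V.starProjection - E.starProjection * (T * V.starProjection)‖ ≤ δ := by
  refine ContinuousLinearMap.opNorm_le_bound _ hδ fun x => ?_
  refine (h _ (V.starProjection_apply_mem x)).trans ?_
  exact mul_le_mul_of_nonneg_left (V.norm_starProjection_apply_le x) hδ

variable [CompleteSpace H]

lemma norm_starProjection_sub_le {V E : Submodule ℂ H} [V.HasOrthogonalProjection]
    [E.HasOrthogonalProjection] {δ ε : ℝ} (hδ : 0 ≤ δ) (hε : 0 ≤ ε)
    (h1 : ∀ v ∈ V, ‖v - E.starProjection v‖ ≤ δ * ‖v‖)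
    (h2 : ∀ e ∈ E, ‖e - V.starProjection e‖ ≤ ε * ‖e‖) :
    ‖V.starProjection - E.starProjection‖ ≤ δ + ε := by
  have e1 := norm_starProjection_mul_one_sub_le (T := 1) hδ h1
  have e2 := norm_starProjection_mul_one_sub_le (T := 1) hε h2
  rw [one_mul] at e1 e2
  rw [← norm_star] at e2
  have e3 : V.starProjection - E.starProjection =
      (V.starProjection - E.starProjection * V.starProjection) -
      star (E.starProjection - V.starProjection * E.starProjection) := by
    rw [star_sub, star_mul, isStarProjection_starProjection.isSelfAdjoint.star_eq,
      isStarProjection_starProjection.isSelfAdjoint.star_eq]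
    abel
  rw [e3]
  exact (norm_sub_le _ _).trans (add_le_add e1 e2)

/-- With `P` the projection, `P T - T P = ((1 - P) T^* P)^* - (1 - P) T P`; hence almost invariance
is required under both `T` and `T^*`. -/
lemma norm_commutator_le {E : Submodule ℂ H} [E.HasOrthogonalProjection] {T : H →L[ℂ] H} {ε : ℝ}
    (hε : 0 ≤ ε) (h1 : ∀ e ∈ E, ‖T e - E.starProjection (T e)‖ ≤ ε * ‖e‖)
    (h2 : ∀ e ∈ E, ‖(star T) e - E.starProjection ((star T) e)‖ ≤ ε * ‖e‖) :
    ‖E.starProjection * T - T * E.starProjection‖ ≤ 2 * ε := by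
  have e1 := norm_starProjection_mul_one_sub_le hε h1
  have e2 := norm_starProjection_mul_one_sub_le hε h2
  rw [← norm_star] at e2
  have e3 : E.starProjection * T - T * E.starProjection =
      star (star T * E.starProjection - E.starProjection * (star T * E.starProjection)) -
      (T * E.starProjection - E.starProjection * (T * E.starProjection)) := by
    rw [star_sub, star_mul, star_mul, star_mul, star_star,
      isStarProjection_starProjection.isSelfAdjoint.star_eq]
    noncomm_ring
  rw [e3]
  exact (norm_sub_le _ _).trans (by linarith)

/-- A sequence of finite rank projections converging strongly to `1` is, up to passing to a
subsequence, a norm-small perturbation of an increasing one. -/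
lemma exists_monotone_submodule {W : ℕ → Submodule ℂ H} [∀ n, FiniteDimensional ℂ (W n)]
    (hW : ∀ ξ, Tendsto (fun n => ‖ξ - (W n).starProjection ξ‖) atTop (𝓝 0)) :
    ∃ P : ℕ → (H →L[ℂ] H), (∀ n, IsStarProjection (P n)) ∧
      (∀ n, FiniteDimensional ℂ (LinearMap.range (P n : H →ₗ[ℂ] H))) ∧ Monotone P ∧
      ∃ m : ℕ → ℕ, Tendsto m atTop atTop ∧
        Tendsto (fun n => ‖P n - (W (m n)).starProjection‖) atTop (𝓝 0) := by
  have inst : ∀ V : {V : Submodule ℂ H // FiniteDimensional ℂ V}, V.1.HasOrthogonalProjection :=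
    fun V => haveI := V.2; inferInstance
  have step : ∀ (V : {V : Submodule ℂ H // FiniteDimensional ℂ V}) (k : ℕ),
      ∃ V' : {V : Submodule ℂ H // FiniteDimensional ℂ V}, V.1 ≤ V'.1 ∧ ∃ n, k ≤ n ∧
        ‖V'.1.starProjection - (W n).starProjection‖ ≤ 1 / ((k : ℝ) + 1) := by
    rintro ⟨V, hV⟩ k
    -- The perturbation costs `δ + 2 δ = 3 δ`, so this `δ` leaves `1 / (2 (k + 1))`.
    have hk : 0 < 1 / (6 * ((k : ℝ) + 1)) := by positivity
    obtain ⟨n, hn, hkn⟩ := ((norm_sub_starProjection_eventually_le hW V hk).and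
      (eventually_ge_atTop k)).exists
    have hk2 : 1 / (6 * ((k : ℝ) + 1)) ≤ 1 / 2 :=
      one_div_le_one_div_of_le two_pos (by
        have : (0 : ℝ) ≤ k := k.cast_nonneg
        linarith)
    obtain ⟨V', hfin, hVV', h1, h2⟩ := exists_perturbed_submodule hk.le hk2 hn
    refine ⟨⟨V', hfin⟩, hVV', n, hkn, ?_⟩
    refine (norm_starProjection_sub_le hk.le (mul_nonneg two_pos.le hk.le) h1 fun e he => ?_).trans
      ?_
    · obtain ⟨x, hx, hle⟩ := h2 e he
      exact (norm_sub_starProjection_le V' e hx).trans hle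
    · have : 1 / (6 * ((k : ℝ) + 1)) + 2 * (1 / (6 * ((k : ℝ) + 1))) =
          (1 / 2) * (1 / ((k : ℝ) + 1)) := by
        field_simp; norm_num
      rw [this]
      have : 0 < 1 / ((k : ℝ) + 1) := by positivity
      linarith
  choose f hf m hm hfm using step
  let X : ℕ → {V : Submodule ℂ H // FiniteDimensional ℂ V} := fun k =>
    Nat.rec ⟨⊥, inferInstance⟩ (fun k V => f V k) k
  refine ⟨fun k => (X (k + 1)).1.starProjection, fun _ => isStarProjection_starProjection,
    fun n => ?_, ?_, fun k => m (X k) k, tendsto_atTop_mono (fun k => hm _ k) tendsto_id, ?_⟩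
  · rw [Submodule.range_starProjection]; exact (X (n + 1)).2
  · exact monotone_nat_of_le_succ fun k =>
      Submodule.starProjection_le_starProjection_iff.2 (hf (X (k + 1)) (k + 1))
  · exact squeeze_zero (fun _ => norm_nonneg _) (fun k => hfm (X k) k)
      tendsto_one_div_add_atTop_nhds_zero_nat

end Projections

/-! ### Quasidiagonality and the conclusion -/

section Quasidiagonal

variable {A : Type*} [CStarAlgebra A]

lemma injective_of_isSimpleCStar (hA : IsSimpleCStar A) {H : Type*} [NormedAddCommGroup H]
    [InnerProductSpace ℂ H] [CompleteSpace H] (π : A →⋆ₙₐ[ℂ] (H →L[ℂ] H)) (hπ : π 1 ≠ 0) :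
    Function.Injective π := by
  have hcont : Continuous π :=
    AddMonoidHomClass.continuous_of_bound π 1 fun a => by
      rw [one_mul]; exact NonUnitalStarAlgHom.norm_apply_le π a
  have hclosed : IsClosed (TwoSidedIdeal.ker π : Set A) := by
    have : (TwoSidedIdeal.ker π : Set A) = π ⁻¹' {0} := by
      ext x; exact TwoSidedIdeal.mem_ker π
    rw [this]
    exact isClosed_singleton.preimage hcont
  rcases hA.2 _ hclosed with h | h
  · rw [injective_iff_map_eq_zero]
    intro a ha
    have : a ∈ TwoSidedIdeal.ker π := (TwoSidedIdeal.mem_ker π).2 ha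
    rw [h] at this
    exact (TwoSidedIdeal.mem_bot A).1 this
  · exact absurd ((TwoSidedIdeal.mem_ker π).1 (h ▸ trivial : (1 : A) ∈ TwoSidedIdeal.ker π)) hπ

variable [PartialOrder A] [StarOrderedRing A]

/-- Almost reducing subspaces in the GNS representation of one state give quasidiagonality. -/
lemma isQuasidiagonal_of_almostReducing [TopologicalSpace.SeparableSpace A]
    (hA : IsSimpleCStar A) {ω : WeakDual ℂ A} (hω : ω ∈ stateSpace A) {u : ℕ → A}
    (hu : DenseRange u) {F : ℕ → Finset A} {ε : ℕ → ℝ} (hε : ∀ k, 0 ≤ ε k)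
    (hε0 : Tendsto ε atTop (𝓝 0)) (hF : ∀ i, ∀ᶠ k in atTop, u i ∈ F k ∧ star (u i) ∈ F k)
    (h : ∀ k, AlmostReducing ω (F k) (ε k)) : IsQuasidiagonal A := by
  obtain ⟨H, i1, i2, i3, π, v, hπv, hv, hdense⟩ := exists_gns_type hω
  choose E hEfin hE1 hE2 using h
  let W : ℕ → Submodule ℂ H := fun k => (E k).map v
  have hWfin : ∀ k, FiniteDimensional ℂ (W k) := fun k => inferInstance
  have hW1 : ∀ k, ∀ a ∈ F k, ∀ w ∈ W k,
      ‖π a w - (W k).starProjection (π a w)‖ ≤ ε k * ‖w‖ := by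
    rintro k a ha _ ⟨e, he, rfl⟩
    obtain ⟨e', he', hle⟩ := hE1 k a ha e he
    refine (norm_sub_starProjection_le (W k) _ (Submodule.mem_map_of_mem he')).trans ?_
    rw [hπv, ← map_sub]
    rw [← hv, ← hv, ← mul_pow] at hle
    exact (sq_le_sq₀ (norm_nonneg _) (mul_nonneg (hε k) (norm_nonneg _))).1 hle
  have hW2 : ∀ k, ∀ a ∈ F k, ‖v a - (W k).starProjection (v a)‖ ≤ ε k := by
    intro k a ha
    obtain ⟨e', he', hle⟩ := hE2 k a ha
    refine (norm_sub_starProjection_le (W k) _ (Submodule.mem_map_of_mem he')).trans ?_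
    rw [← map_sub]
    rw [← hv] at hle
    exact (sq_le_sq₀ (norm_nonneg _) (hε k)).1 hle
  have hvcont : Continuous v := by
    refine AddMonoidHomClass.continuous_of_bound v 1 fun a => ?_
    rw [one_mul, ← sq_le_sq₀ (norm_nonneg _) (norm_nonneg _), hv]
    exact state_star_mul_self_le hω a
  -- The vectors `v (u i)` are dense, and the second clause of `AlmostReducing` places each of them
  -- within `ε k` of `W k` for large `k`.
  have hstrong : ∀ ξ, Tendsto (fun n => ‖ξ - (W n).starProjection ξ‖) atTop (𝓝 0) := by
    refine tendsto_zero_of_dense (K := 2) two_pos.le (fun _ _ => norm_nonneg _) (fun n x y => ?_)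
      (hdense.comp hu hvcont) fun i => ?_
    · have e1 : x - (W n).starProjection x = (y - (W n).starProjection y) +
          ((x - y) - (W n).starProjection (x - y)) := by rw [map_sub]; abel
      rw [e1]
      refine (norm_add_le _ _).trans (add_le_add le_rfl ((norm_sub_le _ _).trans ?_))
      linarith [(W n).norm_starProjection_apply_le (x - y)]
    · exact squeeze_zero' (Eventually.of_forall fun _ => norm_nonneg _)
        ((hF i).mono fun k hk => hW2 k _ hk.1) hε0
  obtain ⟨P, hP, hPfin, hmono, m, hm, hPW⟩ := exists_monotone_submodule hstrong
  have hπ1 : ∀ a, ‖π a‖ ≤ ‖a‖ := NonUnitalStarAlgHom.norm_apply_le π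
  refine ⟨H, i1, i2, i3, π, P, injective_of_isSimpleCStar hA π fun h0 => ?_, hP, hPfin, hmono,
    fun ξ => ?_, fun a => ?_⟩
  · have h1 := hπv 1 1
    rw [h0, mul_one] at h1
    have h2 := hv 1
    rw [← h1, star_one, mul_one, hω.1] at h2
    simp at h2
  · rw [tendsto_iff_norm_sub_tendsto_zero]
    have h1 := (hPW.mul_const ‖ξ‖).add ((hstrong ξ).comp hm)
    rw [zero_mul, add_zero] at h1
    refine squeeze_zero (fun _ => norm_nonneg _) (fun n => ?_) h1
    have e1 : P n ξ - ξ = (P n - (W (m n)).starProjection) ξ -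
        (ξ - (W (m n)).starProjection ξ) := by
      rw [_root_.sub_apply]; abel
    rw [e1]
    exact (norm_sub_le _ _).trans (add_le_add (ContinuousLinearMap.le_opNorm _ _) le_rfl)
  · have hcomm : Tendsto (fun n => ‖(W n).starProjection * π a - π a * (W n).starProjection‖)
        atTop (𝓝 0) := by
      refine tendsto_zero_of_dense (K := 2)
        (f := fun n a => ‖(W n).starProjection * π a - π a * (W n).starProjection‖) two_pos.le
        (fun _ _ => norm_nonneg _) (fun n x y => ?_) hu (fun i => ?_) a
      · have e1 : (W n).starProjection * π x - π x * (W n).starProjection =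
            ((W n).starProjection * π y - π y * (W n).starProjection) +
            ((W n).starProjection * π (x - y) - π (x - y) * (W n).starProjection) := by
          rw [map_sub]; noncomm_ring
        rw [e1]
        refine (norm_add_le _ _).trans (add_le_add le_rfl ((norm_sub_le _ _).trans ?_))
        have h1 := hπ1 (x - y)
        have h2 : ‖(W n).starProjection‖ ≤ 1 := (W n).starProjection_norm_le
        have h3 := norm_mul_le (W n).starProjection (π (x - y))
        have h4 := norm_mul_le (π (x - y)) (W n).starProjection
        nlinarith [norm_nonneg (π (x - y)), norm_nonneg (W n).starProjection]
      · have h2 : Tendsto (fun k => 2 * ε k) atTop (𝓝 0) := by simpa using hε0.const_mul 2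
        refine squeeze_zero' (Eventually.of_forall fun _ => norm_nonneg _)
          ((hF i).mono fun k hk => ?_) h2
        refine norm_commutator_le (hε k) (hW1 k _ hk.1) ?_
        rw [← map_star]
        exact hW1 k _ hk.2
    have h1 := (hcomm.comp hm).add ((hPW.mul_const ‖π a‖).const_mul 2)
    rw [zero_mul, mul_zero, add_zero] at h1
    refine squeeze_zero (fun _ => norm_nonneg _) (fun n => ?_) h1
    set Q := (W (m n)).starProjection
    have e1 : P n * π a - π a * P n = (Q * π a - π a * Q) +
        ((P n - Q) * π a - π a * (P n - Q)) := by noncomm_ring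
    rw [e1]
    refine (norm_add_le _ _).trans (add_le_add le_rfl ((norm_sub_le _ _).trans ?_))
    have h3 := norm_mul_le (P n - Q) (π a)
    have h4 := norm_mul_le (π a) (P n - Q)
    linarith

/-- A separable simple `C⋆`-algebra with a corner system is quasidiagonal. -/
lemma CornerSystem.isQuasidiagonal [TopologicalSpace.SeparableSpace A] (S : CornerSystem A)
    (hA : IsSimpleCStar A) : IsQuasidiagonal A := by
  classical
  have := hA.1
  let u := TopologicalSpace.denseSeq A
  -- Adjoints are included because the commutator estimate needs almost invariance under them too.
  let F : ℕ → Finset A := fun k =>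
    (Finset.range (k + 1)).image u ∪ (Finset.range (k + 1)).image fun i => star (u i)
  obtain ⟨ω, hω, h⟩ := S.exists_state_almostReducing hA F
    (ε := fun k => 1 / ((k : ℝ) + 1)) fun k => by positivity
  refine isQuasidiagonal_of_almostReducing hA hω (TopologicalSpace.denseRange_denseSeq A)
    (fun k => by positivity) tendsto_one_div_add_atTop_nhds_zero_nat (fun i => ?_) h
  filter_upwards [eventually_ge_atTop i] with k hk
  have hi : i ∈ Finset.range (k + 1) := Finset.mem_range.2 (Nat.lt_succ_of_le hk)
  exact ⟨Finset.mem_union_left _ (Finset.mem_image_of_mem _ hi),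
    Finset.mem_union_right _ (Finset.mem_image_of_mem _ hi)⟩

end Quasidiagonal

theorem mainTheorem10 {A : Type*} [CStarAlgebra A] [PartialOrder A] [StarOrderedRing A]
    [TopologicalSpace.SeparableSpace A] (hsimple : IsSimpleCStar A) (hA : InClassC1 A) :
    IsMF A ∧ IsQuasidiagonal A ∧ ∃ τ : A →ₗ[ℂ] ℂ, IsTracialState τ := by
  have := hsimple.1
  obtain ⟨S⟩ := nonempty_cornerSystem hA
  exact ⟨S.isMF hsimple, S.isQuasidiagonal hsimple, S.exists_tracialState⟩
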